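/- All locally compact spaces are Hausdorff and second countable. For a locally compact space $T$ and an open set $\Omega\subset T\times\mathbb{R}^k$, a function $f$ on $\Omega$ with values in some $\mathbb{R}^m$ is $C^{\infty,0}$ if each $f^t=f(t,\cdot)$ is smooth and $t\mapsto f^t$ is continuous for uniform convergence, on compact sets, of all derivatives. A continuous family of manifolds over $T$ is a locally compact space $X$ with a continuous open surjection $p:X\to T$ and, for some $k\ge 1$, an atlas of fibre preserving homeomorphisms $\phi:U\to p(U)\times V$ ($U\subset X$ and $V\subset\mathbb{R}^k$ open, the sets $U$ covering $X$) whose changes of charts are $C^{\infty,0}$. A morphism from $(X_1,p_1)$ over $T_1$ to $(X_2,p_2)$ over $T_2$ is a pair $(f,q)$ of continuous maps $f:X_1\to X_2$, $q:T_1\to T_2$ with $p_2\circ f=q\circ p_1$, such that in charts $f$ has the form $(t,w)\mapsto(q(t),f^t(w))$ with $(t,w)\mapsto f^t(w)$ being $C^{\infty,0}$. A function on $X$ is $C^{\infty,0}$ if it is continuous and $C^{\infty,0}$ in every chart, and $C_c^{\infty,0}(X)$ is the set of those with compact support. Let $G$ be a continuous family groupoid: a locally compact groupoid with range and source maps $r,s:G\to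 G^0$ such that $(G,r)$ and $(G,s)$ are continuous families of manifolds over $G^0$, the inversion $(G,r)\to(G,s)$ and its inverse are morphisms over $\mathrm{id}_{G^0}$, and the multiplication, from $G*G=\{(g,h):s(g)=r(h)\}$, regarded as a continuous family over $G$ by $(g,h)\mapsto g$ (the pull-back of $(G,r)$ along $s$), to $(G,r)$, is a morphism over $r$. Let $\{\lambda^u\}_{u\in G^0}$ be a continuous left Haar system on $G$: positive regular Borel measures $\lambda^u$ with support $G^u=r^{-1}(u)$, which in each chart $U\sim r(U)\times W$ of $(G,r)$ are equivalent to Lebesgue measure on $W$ with Radon--Nikodym derivative continuous on $r(U)\times W$, and with $\int f(gh)\,d\lambda^{s(g)}(h)=\int f(h)\,d\lambda^{r(g)}(h)$ for all $g\in G$, $f\in C_c(G)$. Let $(X,p)$ be a proper $C^{\infty,0}$ $G$-space: a continuous family of manifolds over $G^0$ with a continuous action $G*X=\{(g,x):s(g)=p(x)\}\to X$, $(g,x)\mapsto gx$, satisfying $p(gx)=r(g)$, $g(hx)=(gh)x$ and $g^{-1}(gx)=x$, which is a morphism over $r$ from $G*X$, as a continuous family over $G$ by $(g,x)\mapsto g$,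 to $(X,p)$, and such that the map $G*X\to X\times X$, $(g,x)\mapsto(gx,x)$, is proper. Then, for every collection $\{U_\alpha\}_{\alpha\in A}$ of open subsets of $X$ such that the sets $GU_\alpha=\{gx: x\in U_\alpha,\ s(g)=p(x)\}$ cover $X$, there exists a $G$-partition of unity subordinate to $\{U_\alpha\}_{\alpha\in A}$, that is, a collection $\{f_\delta\}_{\delta\in\Delta}$ of non-negative functions in $C_c^{\infty,0}(X)$, each with compact support contained in some $U_\alpha$, such that for each $\delta$ and each $x\in X$ the function $g\mapsto f_\delta(g^{-1}x)$ is $\lambda^{p(x)}$-integrable, and for every $x\in X$ $$\sum_{\delta\in\Delta}\int_{G^{p(x)}}f_\delta(g^{-1}x)\,d\lambda^{p(x)}(g)=1,$$ where the sum is locally finite: every point of $X$ has a neighbourhood on which all but finitely many of the functions $x\mapsto\int_{G^{p(x)}}f_\delta(g^{-1}x)\,d\lambda^{p(x)}(g)$ vanish identically. -/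

import Mathlib

open Set Filter Topology MeasureTheory
open scoped ContDiff

noncomputable section

/-! ### The `C^{∞,0}` condition in coordinates -/

/-- Let `Ω` be an open subset of `T × E` and `f` a function on `Ω` (values outside `Ω` are
irrelevant). `f` is `C^{∞,0}` on `Ω` when every `f^t = f (t, ·)` is smooth on the slice `Ω_t` and
`t ↦ f^t` is continuous for the topology of uniform convergence, on compact sets, of all
derivatives. For `Ω = T × M` this is continuity of `t ↦ f^t` from `T` into `C^∞(M, F)`. -/
def CInfZeroOn {T E F : Type*} [TopologicalSpace T] [NormedAddCommGroup E] [NormedSpace ℝ E]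
    [NormedAddCommGroup F] [NormedSpace ℝ F] (f : T × E → F) (Ω : Set (T × E)) : Prop :=
  (∀ t, ContDiffOn ℝ ∞ (fun w => f (t, w)) {w | (t, w) ∈ Ω}) ∧
  ∀ (n : ℕ) (t : T) (K : Set E), IsCompact K → K ⊆ {w | (t, w) ∈ Ω} →
    TendstoUniformlyOn (fun t' => iteratedFDeriv ℝ n (fun w => f (t', w)))
      (iteratedFDeriv ℝ n (fun w => f (t, w))) (𝓝 t) K

section CInfZero

variable {T T' E F : Type*} [TopologicalSpace T] [TopologicalSpace T']
  [NormedAddCommGroup E] [NormedSpace ℝ E] [NormedAddCommGroup F] [NormedSpace ℝ F]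

/-- On open sets, `f` is `C^{∞,0}` iff it is smooth along the slices and all its derivatives along
the slices are jointly continuous. -/
theorem cInfZeroOn_iff [FiniteDimensional ℝ E] {f : T × E → F} {Ω : Set (T × E)}
    (hΩ : IsOpen Ω) :
    CInfZeroOn f Ω ↔ (∀ t, ContDiffOn ℝ ∞ (fun w => f (t, w)) {w | (t, w) ∈ Ω}) ∧
      ∀ n : ℕ, ContinuousOn
        (fun z : T × E => iteratedFDeriv ℝ n (fun w => f (z.1, w)) z.2) Ω := by
  have : ProperSpace E := FiniteDimensional.proper ℝ E
  have hsl : ∀ t, IsOpen {w | (t, w) ∈ Ω} := fun t => hΩ.preimage (by fun_prop)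
  refine and_congr_right fun hs => forall_congr' fun n => ⟨fun h => ?_, fun h => ?_⟩
  · rintro ⟨t, w⟩ hz
    apply ContinuousAt.continuousWithinAt
    obtain ⟨K, hK, hwK, hKΩ⟩ := exists_compact_subset (hsl t) hz
    have hu := h t K hK hKΩ
    have hc : ContinuousOn (iteratedFDeriv ℝ n (fun w => f (t, w))) {w | (t, w) ∈ Ω} :=
      ((hs t).continuousOn_iteratedFDerivWithin
        (by exact_mod_cast (le_top : (n : ℕ∞) ≤ ⊤)) (hsl t).uniqueDiffOn).congr
        fun x hx => (iteratedFDerivWithin_of_isOpen n (hsl t) hx).symm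
    have hcw := hc.continuousAt ((hsl t).mem_nhds hz)
    rw [Metric.continuousAt_iff'] at hcw
    rw [Metric.continuousAt_iff']
    intro ε hε
    rw [Metric.tendstoUniformlyOn_iff] at hu
    rw [nhds_prod_eq]
    filter_upwards [(hu (ε / 2) (half_pos hε)).prod_mk
      ((hcw (ε / 2) (half_pos hε)).and (mem_interior_iff_mem_nhds.1 hwK))]
      with z hz'
    obtain ⟨h1, h2, h3⟩ := hz'
    have h4 := h1 z.2 h3
    rw [dist_comm] at h4
    calc _ ≤ _ := dist_triangle _ (iteratedFDeriv ℝ n (fun w => f (t, w)) z.2) _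
      _ < ε := by linarith
  · intro t K hK hKΩ
    rw [Metric.tendstoUniformlyOn_iff]
    intro ε hε
    obtain ⟨u, v, hu, -, htu, hKv, huv⟩ := generalized_tube_lemma (isCompact_singleton (x := t))
      hK hΩ (by rintro ⟨a, b⟩ ⟨ha, hb⟩; rw [mem_singleton_iff] at ha; subst ha; exact hKΩ hb)
    have htu' : t ∈ u := htu rfl
    obtain ⟨a, ha, hau⟩ := hK.mem_uniformity_of_prod
      (f := fun t' w => iteratedFDeriv ℝ n (fun w => f (t', w)) w) (s := u)
      (h.mono ((prod_mono_right hKv).trans huv)) htu' (Metric.dist_mem_uniformity hε)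
    rw [hu.nhdsWithin_eq htu'] at ha
    filter_upwards [ha] with t' ht' x hx
    rw [dist_comm]
    exact hau t' ht' x hx

theorem CInfZeroOn.congr [FiniteDimensional ℝ E] {f g : T × E → F} {Ω : Set (T × E)}
    (hΩ : IsOpen Ω) (hf : CInfZeroOn f Ω) (hfg : ∀ z ∈ Ω, g z = f z) : CInfZeroOn g Ω := by
  rw [cInfZeroOn_iff hΩ] at hf ⊢
  refine ⟨fun t => (hf.1 t).congr fun w hw => hfg _ hw, fun n => (hf.2 n).congr ?_⟩
  rintro ⟨t, w⟩ hz
  have : (fun w => g (t, w)) =ᶠ[𝓝 w] (fun w => f (t, w)) :=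
    eventually_of_mem ((hΩ.preimage (by fun_prop : Continuous fun w => (t, w))).mem_nhds hz)
      fun w hw => hfg _ hw
  exact (Filter.EventuallyEq.iteratedFDeriv ℝ this n).self_of_nhds

theorem CInfZeroOn.pullback {f : T × E → F} {Ω : Set (T × E)} (hf : CInfZeroOn f Ω)
    {t : T' → T} (ht : Continuous t) :
    CInfZeroOn (fun z : T' × E => f (t z.1, z.2)) {z | (t z.1, z.2) ∈ Ω} :=
  ⟨fun a => hf.1 (t a), fun n a K hK hKΩ u hu =>
    (ht.tendsto a).eventually (hf.2 n (t a) K hK hKΩ u hu)⟩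

end CInfZero

/-! ### Continuous families of manifolds -/

/-- The structure of a continuous family of manifolds over `T` on `(X, p)`: an atlas of charts
`φ : U → p(U) × V`, with `V` open in `ℝ^k`, which preserve the fibres and whose changes of charts
are `C^{∞,0}`. (The first component of a change of charts is the identity of `T`, so the condition
is about the second one.) The atlas need not be maximal. -/
structure ContinuousFamily {X T : Type*} [TopologicalSpace X] [TopologicalSpace T]
    (p : X → T) where
  continuous_proj : Continuous p
  isOpenMap_proj : IsOpenMap p
  surjective_proj : Function.Surjective p
  dim : ℕ
  one_le_dim : 1 ≤ dim
  atlas : Set (OpenPartialHomeomorph X (T × EuclideanSpace ℝ (Fin dim)))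
  covers : ∀ x, ∃ φ ∈ atlas, x ∈ φ.source
  target_eq : ∀ φ ∈ atlas, ∃ V : Set (EuclideanSpace ℝ (Fin dim)), IsOpen V ∧
    φ.target = (p '' φ.source) ×ˢ V
  fst_chart : ∀ φ ∈ atlas, ∀ x ∈ φ.source, (φ x).1 = p x
  compatible : ∀ φ ∈ atlas, ∀ ψ ∈ atlas,
    CInfZeroOn (fun z => (ψ (φ.symm z)).2) (φ.target ∩ φ.symm ⁻¹' ψ.source)

/-- `(f, q)` is a morphism (a `C^{∞,0}` map) of continuous families: `f` is continuous and maps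
fibres to fibres over the continuous map `q`, and in charts, on the open set where this makes
sense, `ψ f φ⁻¹ (t, w) = (q t, f^t w)` with `t ↦ f^t` continuous into smooth maps. -/
def IsMorphism {X₁ T₁ X₂ T₂ : Type*} [TopologicalSpace X₁] [TopologicalSpace T₁]
    [TopologicalSpace X₂] [TopologicalSpace T₂] {p₁ : X₁ → T₁} {p₂ : X₂ → T₂}
    (F₁ : ContinuousFamily p₁) (F₂ : ContinuousFamily p₂) (f : X₁ → X₂) (q : T₁ → T₂) : Prop :=
  Continuous f ∧ Continuous q ∧ (∀ x, p₂ (f x) = q (p₁ x)) ∧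
  ∀ φ ∈ F₁.atlas, ∀ ψ ∈ F₂.atlas,
    CInfZeroOn (fun z => (ψ (f (φ.symm z))).2) (φ.target ∩ φ.symm ⁻¹' (f ⁻¹' ψ.source))

/-- Real valued functions of class `C^{∞,0}` on a continuous family. -/
def IsCInfZero {X T : Type*} [TopologicalSpace X] [TopologicalSpace T] {p : X → T}
    (F : ContinuousFamily p) (f : X → ℝ) : Prop :=
  Continuous f ∧ ∀ φ ∈ F.atlas, CInfZeroOn (fun z => f (φ.symm z)) φ.target

section Pullback

variable {X T Z : Type*} [TopologicalSpace X] [TopologicalSpace T] [TopologicalSpace Z]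
  {p : X → T} (t : Z → T)

/-- The fibered product `{(z, x) | t z = p x}`. -/
abbrev FiberedProduct (t : Z → T) (p : X → T) : Type _ := {zx : Z × X // t zx.1 = p zx.2}

open Classical in
/-- The chart `{(z, x) | t z = p x, x ∈ U} → t⁻¹(p(U)) × V`, `(z, x) ↦ (z, (φ x).2)` of the
pull-back, for a chart `φ : U → p(U) × V`. -/
def pullbackChart (F : ContinuousFamily p) (ht : Continuous t)
    (φ : OpenPartialHomeomorph X (T × EuclideanSpace ℝ (Fin F.dim))) (hφ : φ ∈ F.atlas) :
    OpenPartialHomeomorph (FiberedProduct t p) (Z × EuclideanSpace ℝ (Fin F.dim)) where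
  toFun zx := (zx.1.1, (φ zx.1.2).2)
  invFun zw :=
    if h : t zw.1 = p (φ.symm (t zw.1, zw.2)) then ⟨(zw.1, φ.symm (t zw.1, zw.2)), h⟩
    else ⟨(zw.1, (F.surjective_proj (t zw.1)).choose),
      (F.surjective_proj (t zw.1)).choose_spec.symm⟩
  source := {zx | zx.1.2 ∈ φ.source}
  target := {zw | (t zw.1, zw.2) ∈ φ.target}
  map_source' := by
    rintro ⟨⟨z, x⟩, h⟩ hx
    simp only [mem_ofPred_eq] at h hx ⊢
    rw [h, ← F.fst_chart φ hφ x hx]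
    exact φ.map_source hx
  map_target' := by
    rintro ⟨z, w⟩ hw
    simp only [mem_ofPred_eq] at hw ⊢
    have h1 := φ.map_target hw
    have h2 := F.fst_chart φ hφ _ h1
    rw [φ.right_inv hw] at h2
    rw [dif_pos h2]
    exact h1
  left_inv' := by
    rintro ⟨⟨z, x⟩, h⟩ hx
    simp only [mem_ofPred_eq] at h hx
    have h2 : φ.symm (t z, (φ x).2) = x := by
      rw [h, ← F.fst_chart φ hφ x hx]; exact φ.left_inv hx
    simp only [h2]
    rw [dif_pos h]
  right_inv' := by
    rintro ⟨z, w⟩ hw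
    simp only [mem_ofPred_eq] at hw
    have h1 := φ.map_target hw
    have h2 := F.fst_chart φ hφ _ h1
    rw [φ.right_inv hw] at h2
    simp only [dif_pos h2, φ.right_inv hw]
  open_source := φ.open_source.preimage (by fun_prop)
  open_target := φ.open_target.preimage (by fun_prop)
  continuousOn_toFun := by
    refine ContinuousOn.prodMk (by fun_prop) (continuous_snd.comp_continuousOn ?_)
    exact φ.continuousOn.comp (by fun_prop) fun zx hzx => hzx
  continuousOn_invFun := by
    apply Topology.IsInducing.subtypeVal.continuousOn_iff.2
    have : ContinuousOn (fun zw : Z × EuclideanSpace ℝ (Fin F.dim) =>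
        (zw.1, φ.symm (t zw.1, zw.2))) {zw | (t zw.1, zw.2) ∈ φ.target} :=
      ContinuousOn.prodMk (by fun_prop)
        (φ.continuousOn_symm.comp (by fun_prop) fun zw hzw => hzw)
    refine this.congr ?_
    rintro ⟨z, w⟩ hw
    simp only [mem_ofPred_eq] at hw
    have h2 := F.fst_chart φ hφ _ (φ.map_target hw)
    rw [φ.right_inv hw] at h2
    simp only [Function.comp, dif_pos h2]

theorem pullbackChart_symm_val (F : ContinuousFamily p) (ht : Continuous t)
    (φ : OpenPartialHomeomorph X (T × EuclideanSpace ℝ (Fin F.dim))) (hφ : φ ∈ F.atlas)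
    (zw : Z × EuclideanSpace ℝ (Fin F.dim)) (hzw : (t zw.1, zw.2) ∈ φ.target) :
    ((pullbackChart t F ht φ hφ).symm zw).1 = (zw.1, φ.symm (t zw.1, zw.2)) := by
  have h2 := F.fst_chart φ hφ _ (φ.map_target hzw)
  rw [φ.right_inv hzw] at h2
  exact congrArg Subtype.val (dif_pos h2)

/-- The pull-back over `Z`, along a continuous map `t : Z → T`, of a continuous family `(X, p)`
over `T`. In particular, if `(X₁, p₁)`, `(X₂, p₂)` are continuous families over `T`, then the
pull-back of `(X₂, p₂)` along `p₁` is `(X₁ * X₂, t₁)`, a continuous family over `X₁`. -/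
def ContinuousFamily.pullback (F : ContinuousFamily p) (ht : Continuous t) :
    ContinuousFamily (fun zx : FiberedProduct t p => zx.1.1) where
  continuous_proj := by fun_prop
  isOpenMap_proj := by
    intro O hO
    obtain ⟨O', hO', rfl⟩ := isOpen_induced_iff.1 hO
    rw [isOpen_iff_mem_nhds]
    rintro _ ⟨⟨⟨z, x⟩, h⟩, hzx, rfl⟩
    obtain ⟨A, B, hA, hB, hzA, hxB, hAB⟩ := isOpen_prod_iff.1 hO' z x hzx
    have hN : A ∩ t ⁻¹' (p '' B) ∈ 𝓝 z :=
      (hA.inter ((F.isOpenMap_proj B hB).preimage ht)).mem_nhds ⟨hzA, x, hxB, h.symm⟩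
    filter_upwards [hN]
    rintro z' ⟨hz', x', hx', hx'z⟩
    exact ⟨⟨(z', x'), hx'z.symm⟩, hAB ⟨hz', hx'⟩, rfl⟩
  surjective_proj := by
    intro z
    obtain ⟨x, hx⟩ := F.surjective_proj (t z)
    exact ⟨⟨(z, x), hx.symm⟩, rfl⟩
  dim := F.dim
  one_le_dim := F.one_le_dim
  atlas := {χ | ∃ (φ : _) (hφ : φ ∈ F.atlas), χ = pullbackChart t F ht φ hφ}
  covers := by
    rintro ⟨⟨z, x⟩, h⟩
    obtain ⟨φ, hφ, hx⟩ := F.covers x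
    exact ⟨_, ⟨φ, hφ, rfl⟩, hx⟩
  target_eq := by
    rintro _ ⟨φ, hφ, rfl⟩
    obtain ⟨V, hV, hφV⟩ := F.target_eq φ hφ
    refine ⟨V, hV, ?_⟩
    ext ⟨z, w⟩
    change (t z, w) ∈ φ.target ↔ _
    rw [hφV, mem_prod, mem_prod]
    refine and_congr_left fun _ => ⟨?_, ?_⟩
    · rintro ⟨x, hx, hxz⟩
      exact ⟨⟨(z, x), hxz.symm⟩, hx, rfl⟩
    · rintro ⟨⟨⟨z', x⟩, h⟩, hx, rfl⟩
      exact ⟨x, hx, h.symm⟩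
  fst_chart := by
    rintro _ ⟨φ, hφ, rfl⟩ zx _
    rfl
  compatible := by
    rintro _ ⟨φ, hφ, rfl⟩ _ ⟨ψ, hψ, rfl⟩
    have key := (F.compatible φ hφ ψ hψ).pullback ht
    have hset : ((pullbackChart t F ht φ hφ).target ∩
        (pullbackChart t F ht φ hφ).symm ⁻¹' (pullbackChart t F ht ψ hψ).source) =
        {z | (t z.1, z.2) ∈ φ.target ∩ φ.symm ⁻¹' ψ.source} := by
      ext zw
      refine and_congr_right fun hzw => ?_
      change ((pullbackChart t F ht φ hφ).symm zw).1.2 ∈ ψ.source ↔ _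
      rw [pullbackChart_symm_val t F ht φ hφ zw hzw]
      rfl
    rw [hset]
    refine key.congr ?_ ?_
    · exact (φ.isOpen_inter_preimage_symm ψ.open_source).preimage (by fun_prop)
    · rintro zw hzw
      change (ψ ((pullbackChart t F ht φ hφ).symm zw).1.2).2 = _
      rw [pullbackChart_symm_val t F ht φ hφ zw hzw.1]

end Pullback

/-! ### Groupoids and their actions -/

/-- A topological groupoid with space of arrows `G` and space of units `G₀` (embedded in `G` by
`unit`). The product `mul g h` only has a meaning when `s g = r h`. -/
structure TopologicalGroupoid (G G₀ : Type*) [TopologicalSpace G] [TopologicalSpace G₀] where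
  r : G → G₀
  s : G → G₀
  unit : G₀ → G
  mul : G → G → G
  inv : G → G
  r_unit : ∀ u, r (unit u) = u
  s_unit : ∀ u, s (unit u) = u
  r_mul : ∀ g h, s g = r h → r (mul g h) = r g
  s_mul : ∀ g h, s g = r h → s (mul g h) = s h
  mul_assoc : ∀ g h k, s g = r h → s h = r k → mul (mul g h) k = mul g (mul h k)
  unit_mul : ∀ g, mul (unit (r g)) g = g
  mul_unit : ∀ g, mul g (unit (s g)) = g
  r_inv : ∀ g, r (inv g) = s g
  s_inv : ∀ g, s (inv g) = r g
  inv_mul : ∀ g, mul (inv g) g = unit (s g)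
  mul_inv : ∀ g, mul g (inv g) = unit (r g)
  continuous_r : Continuous r
  continuous_s : Continuous s
  continuous_unit : Continuous unit
  continuous_inv : Continuous inv
  continuous_mul : ContinuousOn (fun gh : G × G => mul gh.1 gh.2) {gh | s gh.1 = r gh.2}

/-- A continuous family groupoid. The fibered product `G * G` of `(G, s)` and `(G, r)`, with the
projection `t₁ (g, h) = g`, is the pull-back of `(G, r)` along `s`. -/
structure ContinuousFamilyGroupoid (G G₀ : Type*) [TopologicalSpace G] [TopologicalSpace G₀]
    extends TopologicalGroupoid G G₀ where
  familyS : ContinuousFamily s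
  familyR : ContinuousFamily r
  inv_morphism : IsMorphism familyR familyS inv id
  inv_morphism' : IsMorphism familyS familyR inv id
  mul_morphism : IsMorphism (familyR.pullback s continuous_s) familyR
    (fun gh => mul gh.1.1 gh.1.2) r

/-- A `C^{∞,0}` `G`-space `(X, p)`. The action `act g x` only has a meaning when `s g = p x`. The
fibered product `G * X` of `(G, s)` and `(X, p)`, with the projection `t₁ (g, x) = g`, is the
pull-back of `(X, p)` along `s`. -/
structure CInfZeroGSpace {G G₀ X : Type*} [TopologicalSpace G] [TopologicalSpace G₀]
    [TopologicalSpace X] (𝒢 : ContinuousFamilyGroupoid G G₀) (p : X → G₀) where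
  family : ContinuousFamily p
  act : G → X → X
  proj_act : ∀ g x, 𝒢.s g = p x → p (act g x) = 𝒢.r g
  act_act : ∀ g h x, 𝒢.s g = 𝒢.r h → 𝒢.s h = p x → act g (act h x) = act (𝒢.mul g h) x
  inv_act : ∀ g x, 𝒢.s g = p x → act (𝒢.inv g) (act g x) = x
  continuous_act : ContinuousOn (fun gx : G × X => act gx.1 gx.2) {gx | 𝒢.s gx.1 = p gx.2}
  act_morphism : IsMorphism (family.pullback 𝒢.s 𝒢.continuous_s) family
    (fun gx => act gx.1.1 gx.1.2) 𝒢.r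

section Action

variable {G G₀ X : Type*} [TopologicalSpace G] [TopologicalSpace G₀] [TopologicalSpace X]
  {𝒢 : ContinuousFamilyGroupoid G G₀} {p : X → G₀}

/-- The action is proper: the inverse image of a compact set under the map
`G * X → X × X`, `(g, x) ↦ (g x, x)`, is compact. -/
def CInfZeroGSpace.IsProper (𝒳 : CInfZeroGSpace 𝒢 p) : Prop :=
  ∀ K : Set (X × X), IsCompact K →
    IsCompact {gx : FiberedProduct 𝒢.s p | (𝒳.act gx.1.1 gx.1.2, gx.1.2) ∈ K}

/-- The `G`-saturation `G U` of a subset `U` of `X`. -/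
def CInfZeroGSpace.saturation (𝒳 : CInfZeroGSpace 𝒢 p) (U : Set X) : Set X :=
  {y | ∃ g : G, ∃ x ∈ U, 𝒢.s g = p x ∧ 𝒳.act g x = y}

end Action

/-- A continuous left Haar system on a continuous family groupoid: regular Borel measures
`lam u` with support `G^u = r⁻¹(u)`, which in every chart `(U, φ)` of `(G, r)`, with
`φ(U) = r(U) × W`, are equivalent to Lebesgue measure on `W`, with a Radon-Nikodym derivative that
is continuous on `r(U) × W`, and which are invariant under left multiplication. -/
structure ContinuousLeftHaarSystem {G G₀ : Type*} [TopologicalSpace G] [TopologicalSpace G₀]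
    [MeasurableSpace G] [BorelSpace G] (𝒢 : ContinuousFamilyGroupoid G G₀) where
  lam : G₀ → Measure G
  regular : ∀ u, (lam u).Regular
  support_eq : ∀ u, (lam u).support = 𝒢.r ⁻¹' {u}
  density : ∀ φ ∈ 𝒢.familyR.atlas,
    ∃ ρ : G₀ × EuclideanSpace ℝ (Fin 𝒢.familyR.dim) → ℝ,
      ContinuousOn ρ φ.target ∧ (∀ z ∈ φ.target, 0 ≤ ρ z) ∧
      ∀ u ∈ 𝒢.r '' φ.source,
        ((lam u).restrict φ.source).map (fun g => (φ g).2) =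
          (volume.restrict {w | (u, w) ∈ φ.target}).withDensity
            (fun w => ENNReal.ofReal (ρ (u, w))) ∧
        volume.restrict {w | (u, w) ∈ φ.target} ≪
          ((lam u).restrict φ.source).map (fun g => (φ g).2)
  invariant : ∀ (g : G) (f : G → ℝ), Continuous f → HasCompactSupport f →
    ∫ h, f (𝒢.mul g h) ∂(lam (𝒢.s g)) = ∫ h, f h ∂(lam (𝒢.r g))

/-- `f` is a `G`-partition of unity of `X` subordinate to the collection `U`, relative to the left
Haar system `𝓁`: the `f δ` are non-negative functions in `C^{∞,0}_c(X)`, each with compact support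
in some `U α`, and the sum of the functions `x ↦ ∫ f δ (g⁻¹ x) dλ^{p x}(g)` is locally finite
and equal to `1` at every point. -/
structure IsGPartitionOfUnity {G G₀ X A Δ : Type*} [TopologicalSpace G] [TopologicalSpace G₀]
    [TopologicalSpace X] [MeasurableSpace G] [BorelSpace G]
    {𝒢 : ContinuousFamilyGroupoid G G₀} {p : X → G₀} (𝒳 : CInfZeroGSpace 𝒢 p)
    (𝓁 : ContinuousLeftHaarSystem 𝒢) (U : A → Set X) (f : Δ → X → ℝ) : Prop where
  cInfZero : ∀ δ, IsCInfZero 𝒳.family (f δ)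
  nonneg : ∀ δ x, 0 ≤ f δ x
  hasCompactSupport : ∀ δ, HasCompactSupport (f δ)
  subordinate : ∀ δ, ∃ α, tsupport (f δ) ⊆ U α
  integrable : ∀ δ x, Integrable (fun g => f δ (𝒳.act (𝒢.inv g) x)) (𝓁.lam (p x))
  locallyFinite : LocallyFinite fun δ =>
    Function.support fun x => ∫ g, f δ (𝒳.act (𝒢.inv g) x) ∂(𝓁.lam (p x))
  sum_eq_one : ∀ x, ∑ᶠ δ, ∫ g, f δ (𝒳.act (𝒢.inv g) x) ∂(𝓁.lam (p x)) = 1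

end

set_option linter.unusedSectionVars false

/-! For `f` in `C_c^{∞,0}(X)` let `Pf x = ∫ f (g⁻¹ x) dλ^{p x}(g)` (`average`). Properness confines
the relevant `g` to a compact set, locally uniformly in `x`, so `Pf` is finite and of class
`C^{∞,0}` (`isCInfZero_average`). Left invariance of the Haar system makes `Pf` constant on orbits
(`average_act`), full support makes it positive wherever the orbit meets `{f > 0}` (`average_pos`),
and `P(θ f) = θ Pf` for invariant `θ` (`average_mul`).

Since the saturations cover `X`, the Lindelöf property yields countably many bump functions `h n`,
each supported in some `U α`, whose averages `a n` have no common zero. The cutoffs `c n = ∏_{i<n} b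
(1 - n * a i)`, with `b` smooth, zero on `(-∞, 0]` and positive on `(0, ∞)`, are invariant, make the
family `c n * a n` locally finite, and leave its sum `S` positive. Then `f n = S⁻¹ * c n * h n`
works: its support lies in that of `h n`, and its average is `S⁻¹ * c n * a n`.

The analytic core is the regularity of `Pf`. Charts of `G` turn the varying measures into Lebesgue
measure with a continuous density depending only on the base point and the integration variable.
Slice derivatives therefore never fall on the density, and differentiation under the integral
proceeds by induction on the order. The recursive class `CnZeroOn` is designed for such inductions.
-/

/-! ### Calculus of `C^{n,0}` functions -/

/-- A recursive form of the condition `C^{n,0}` on an open set: `f` is jointly continuous and, if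
`n > 0`, has a derivative along the slices which is `C^{n-1,0}`. -/
def CnZeroOn {T : Type*} [TopologicalSpace T] {E : Type} [NormedAddCommGroup E]
    [NormedSpace ℝ E] : ∀ (_ : ℕ) {F : Type} [NormedAddCommGroup F] [NormedSpace ℝ F]
    (_ : T × E → F) (_ : Set (T × E)), Prop
  | 0, _, _, _, f, Ω => ContinuousOn f Ω
  | n + 1, F, _, _, f, Ω => ContinuousOn f Ω ∧ ∃ f' : T × E → E →L[ℝ] F,
      (∀ z ∈ Ω, HasFDerivAt (fun w => f (z.1, w)) (f' z) z.2) ∧ CnZeroOn n f' Ω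

theorem slice_mem_nhds {T E : Type*} [TopologicalSpace T] [TopologicalSpace E]
    {Ω : Set (T × E)} (hΩ : IsOpen Ω) {z : T × E} (hz : z ∈ Ω) :
    {w | (z.1, w) ∈ Ω} ∈ 𝓝 z.2 :=
  (hΩ.preimage (by fun_prop : Continuous fun w => (z.1, w))).mem_nhds hz

section CnZero

variable {T T' : Type*} [TopologicalSpace T] [TopologicalSpace T']
  {E E' F F₁ F₂ : Type} [NormedAddCommGroup E] [NormedSpace ℝ E]
  [NormedAddCommGroup E'] [NormedSpace ℝ E'] [NormedAddCommGroup F] [NormedSpace ℝ F]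
  [NormedAddCommGroup F₁] [NormedSpace ℝ F₁] [NormedAddCommGroup F₂] [NormedSpace ℝ F₂]

namespace CnZeroOn

theorem continuousOn : ∀ {n : ℕ} {f : T × E → F} {Ω : Set (T × E)},
    CnZeroOn n f Ω → ContinuousOn f Ω
  | 0, _, _, h => h
  | _ + 1, _, _, h => h.1

theorem of_succ {n : ℕ} {f : T × E → F} {Ω : Set (T × E)} (h : CnZeroOn (n + 1) f Ω) :
    CnZeroOn n f Ω := by
  induction n generalizing F with
  | zero => exact h.1
  | succ n ih =>
    obtain ⟨hc, f', hf', h'⟩ := h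
    exact ⟨hc, f', hf', ih h'⟩

theorem congr {n : ℕ} {f g : T × E → F} {Ω : Set (T × E)} (hΩ : IsOpen Ω)
    (h : CnZeroOn n f Ω) (hfg : ∀ z ∈ Ω, g z = f z) : CnZeroOn n g Ω := by
  cases n with
  | zero => exact ContinuousOn.congr h hfg
  | succ n =>
    obtain ⟨hc, f', hf', h'⟩ := h
    refine ⟨hc.congr hfg, f', fun z hz => (hf' z hz).congr_of_eventuallyEq ?_, h'⟩
    filter_upwards [slice_mem_nhds hΩ hz] with w hw using hfg _ hw

theorem add {n : ℕ} {f g : T × E → F} {Ω : Set (T × E)} (hf : CnZeroOn n f Ω)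
    (hg : CnZeroOn n g Ω) : CnZeroOn n (fun z => f z + g z) Ω := by
  induction n generalizing F with
  | zero => exact ContinuousOn.add hf hg
  | succ n ih =>
    obtain ⟨hc, f', hf', h'⟩ := hf
    obtain ⟨hd, g', hg', k'⟩ := hg
    exact ⟨hc.add hd, _, fun z hz => (hf' z hz).add (hg' z hz), ih h' k'⟩

/-- By Leibniz the slice derivative is a sum of two bilinear expressions with values in `E →L[ℝ] F`,
so the induction runs over all target spaces at once. Products and the chain rule are instances. -/
theorem bilinear (B : F₁ →L[ℝ] F₂ →L[ℝ] F) {n : ℕ} {f : T × E → F₁} {g : T × E → F₂}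
    {Ω : Set (T × E)} (hf : CnZeroOn n f Ω) (hg : CnZeroOn n g Ω) :
    CnZeroOn n (fun z => B (f z) (g z)) Ω := by
  induction n generalizing F F₁ F₂ with
  | zero => exact (B.continuous.comp_continuousOn (continuousOn hf)).clm_apply (continuousOn hg)
  | succ n ih =>
    have hf0 := hf.of_succ
    have hg0 := hg.of_succ
    obtain ⟨hc, f', hf', h'⟩ := hf
    obtain ⟨hd, g', hg', k'⟩ := hg
    exact ⟨(B.continuous.comp_continuousOn hc).clm_apply hd, _,
      fun z hz => B.hasFDerivAt_of_bilinear (hf' z hz) (hg' z hz),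
      (ih (B.precompR E) hf0 k').add (ih (B.precompL E) h' hg0)⟩

theorem mul {n : ℕ} {f g : T × E → ℝ} {Ω : Set (T × E)} (hf : CnZeroOn n f Ω)
    (hg : CnZeroOn n g Ω) : CnZeroOn n (fun z => f z * g z) Ω :=
  bilinear (ContinuousLinearMap.mul ℝ ℝ) hf hg

theorem comp {n : ℕ} {k : T' × E' → F} {Ω' : Set (T' × E')} (hk : CnZeroOn n k Ω')
    {q : T × E → T'} {Ω : Set (T × E)} (hq : ContinuousOn q Ω)
    (hΩ : IsOpen Ω) (hq1 : ∀ z ∈ Ω, ∀ w, (z.1, w) ∈ Ω → q (z.1, w) = q z)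
    {f : T × E → E'} (hf : CnZeroOn n f Ω)
    (hmap : ∀ z ∈ Ω, (q z, f z) ∈ Ω') : CnZeroOn n (fun z => k (q z, f z)) Ω := by
  induction n generalizing F with
  | zero => exact ContinuousOn.comp hk (hq.prodMk hf) hmap
  | succ n ih =>
    have hf0 := hf.of_succ
    obtain ⟨hc, k', hk', h'⟩ := hk
    obtain ⟨hd, f', hf', h2'⟩ := hf
    refine ⟨hc.comp (hq.prodMk hd) hmap, fun z => (k' (q z, f z)).comp (f' z), fun z hz => ?_,
      bilinear (ContinuousLinearMap.compL ℝ E E' F) (ih h' hf0) h2'⟩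
    refine ((hk' _ (hmap z hz)).comp z.2 (hf' z hz)).congr_of_eventuallyEq ?_
    filter_upwards [slice_mem_nhds hΩ hz] with w hw
    simp only [Function.comp, hq1 z hz w hw]

theorem of_contDiffOn {n : ℕ} {b : E → F} {s : Set E} (hs : IsOpen s) (hb : ContDiffOn ℝ n b s) :
    CnZeroOn n (fun z : T × E => b z.2) {z | z.2 ∈ s} := by
  induction n generalizing F with
  | zero => exact hb.continuousOn.comp (by fun_prop) fun z hz => hz
  | succ n ih =>
    have h2 := (contDiffOn_succ_iff_fderiv_of_isOpen (n := n) hs).1 (by exact_mod_cast hb)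
    exact ⟨hb.continuousOn.comp (by fun_prop) fun z hz => hz, fun z => fderiv ℝ b z.2,
      fun z hz => (h2.1.differentiableAt (hs.mem_nhds hz)).hasFDerivAt, ih h2.2.2⟩

theorem smooth_comp {n : ℕ} {b : E' → F} {s : Set E'} (hs : IsOpen s) (hb : ContDiffOn ℝ n b s)
    {f : T × E → E'} {Ω : Set (T × E)} (hΩ : IsOpen Ω) (hf : CnZeroOn n f Ω)
    (hmap : ∀ z ∈ Ω, f z ∈ s) : CnZeroOn n (fun z => b (f z)) Ω :=
  comp (of_contDiffOn (T := T) hs hb) continuousOn_fst hΩ (fun _ _ _ _ => rfl) hf hmap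

theorem of_fst {n : ℕ} {c : T → F} {Ω : Set (T × E)}
    (hc : ContinuousOn (fun z : T × E => c z.1) Ω) :
    CnZeroOn n (fun z : T × E => c z.1) Ω := by
  have h0 : ∀ (m : ℕ) (F : Type) [NormedAddCommGroup F] [NormedSpace ℝ F],
      CnZeroOn m (fun _ : T × E => (0 : F)) Ω := by
    intro m
    induction m with
    | zero => intro F _ _; exact continuousOn_const
    | succ m ih =>
      intro F _ _
      exact ⟨continuousOn_const, fun _ => 0, fun z _ => hasFDerivAt_const _ _, ih _⟩
  cases n with
  | zero => exact hc
  | succ n => exact ⟨hc, fun _ => 0, fun z _ => hasFDerivAt_const (c z.1) z.2, h0 _ _⟩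

end CnZeroOn

/-- Up to a linear isometry, the derivative of order `m + 1` of `f` is the derivative of order `m`
of `fderiv f`, so joint continuity passes from one to the other. -/
theorem cnZeroOn_iff {n : ℕ} {f : T × E → F} {Ω : Set (T × E)} (hΩ : IsOpen Ω) :
    CnZeroOn n f Ω ↔ (∀ t, ContDiffOn ℝ n (fun w => f (t, w)) {w | (t, w) ∈ Ω}) ∧
      ∀ m ≤ n, ContinuousOn
        (fun z : T × E => iteratedFDeriv ℝ m (fun w => f (z.1, w)) z.2) Ω := by
  have hsl : ∀ t, IsOpen {w | (t, w) ∈ Ω} := fun t => hΩ.preimage (by fun_prop)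
  have hzero : ∀ (F : Type) [NormedAddCommGroup F] [NormedSpace ℝ F] (f : T × E → F),
      ContinuousOn (fun z : T × E => iteratedFDeriv ℝ 0 (fun w => f (z.1, w)) z.2) Ω ↔
        ContinuousOn f Ω := by
    intro F _ _ f
    have : (fun z : T × E => iteratedFDeriv ℝ 0 (fun w => f (z.1, w)) z.2) =
        (continuousMultilinearCurryFin0 ℝ E F).symm ∘ f := by
      ext z; simp [iteratedFDeriv_zero_eq_comp]
    rw [this]
    exact (continuousMultilinearCurryFin0 ℝ E F).symm.toHomeomorph.comp_continuousOn_iff _ _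
  have hsucc : ∀ (m : ℕ) (F : Type) [NormedAddCommGroup F] [NormedSpace ℝ F] (f : T × E → F),
      ContinuousOn (fun z : T × E => iteratedFDeriv ℝ (m + 1) (fun w => f (z.1, w)) z.2) Ω ↔
        ContinuousOn (fun z : T × E => iteratedFDeriv ℝ m
          (fun w => fderiv ℝ (fun w => f (z.1, w)) w) z.2) Ω := by
    intro m F _ _ f
    simp_rw [iteratedFDeriv_succ_eq_comp_right]
    exact (continuousMultilinearCurryRightEquiv' ℝ m E F).symm.toHomeomorph.comp_continuousOn_iff
      (fun z : T × E => iteratedFDeriv ℝ m (fun w => fderiv ℝ (fun w => f (z.1, w)) w) z.2) _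
  induction n generalizing F with
  | zero =>
    refine ⟨fun h => ⟨fun t => ?_, fun m hm => ?_⟩, fun h => (hzero _ _).1 (h.2 0 le_rfl)⟩
    · simp only [Nat.cast_zero, contDiffOn_zero]
      exact ContinuousOn.comp h (by fun_prop) fun w hw => hw
    · obtain rfl : m = 0 := by omega
      exact (hzero _ _).2 h
  | succ n ih =>
    have hcd : ∀ t, ContDiffOn ℝ ((n + 1 : ℕ) : WithTop ℕ∞) (fun w => f (t, w)) {w | (t, w) ∈ Ω} ↔
        DifferentiableOn ℝ (fun w => f (t, w)) {w | (t, w) ∈ Ω} ∧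
        ContDiffOn ℝ n (fderiv ℝ (fun w => f (t, w))) {w | (t, w) ∈ Ω} := by
      intro t
      push_cast
      rw [contDiffOn_succ_iff_fderiv_of_isOpen (hsl t)]
      simp
    constructor
    · rintro ⟨hc, f', hf', h'⟩
      have h2 : CnZeroOn n (fun z : T × E => fderiv ℝ (fun w => f (z.1, w)) z.2) Ω :=
        h'.congr hΩ fun z hz => (hf' z hz).fderiv
      replace h2 := ih.1 h2
      refine ⟨fun t => (hcd t).2 ⟨fun w hw => (hf' _ hw).differentiableAt.differentiableWithinAt,
        h2.1 t⟩, fun m hm => ?_⟩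
      cases m with
      | zero => exact (hzero _ _).2 hc
      | succ m => exact (hsucc _ _ _).2 (h2.2 m (by omega))
    · rintro ⟨h1, h2⟩
      refine ⟨(hzero _ _).1 (h2 0 (by omega)), fun z => fderiv ℝ (fun w => f (z.1, w)) z.2,
        fun z hz => ?_, ih.2 ⟨fun t => ((hcd t).1 (h1 t)).2, fun m hm => ?_⟩⟩
      · exact (((hcd z.1).1 (h1 z.1)).1.differentiableAt (slice_mem_nhds hΩ hz)).hasFDerivAt
      · exact (hsucc _ _ _).1 (h2 (m + 1) (by omega))

theorem cInfZeroOn_iff_forall_cnZeroOn [FiniteDimensional ℝ E] {f : T × E → F}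
    {Ω : Set (T × E)} (hΩ : IsOpen Ω) : CInfZeroOn f Ω ↔ ∀ n : ℕ, CnZeroOn n f Ω := by
  rw [cInfZeroOn_iff hΩ]
  simp_rw [cnZeroOn_iff hΩ]
  refine ⟨fun h n => ⟨fun t => (h.1 t).of_le (by exact_mod_cast le_top), fun m _ => h.2 m⟩,
    fun h => ⟨fun t => contDiffOn_infty.2 fun n => (h n).1 t, fun n => (h n).2 n le_rfl⟩⟩

theorem CInfZeroOn.mono {f : T × E → F} {Ω Ω' : Set (T × E)} (hf : CInfZeroOn f Ω)
    (h : Ω' ⊆ Ω) : CInfZeroOn f Ω' :=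
  ⟨fun t => (hf.1 t).mono fun _ hw => h hw,
    fun n t K hK hKΩ => hf.2 n t K hK fun _ hw => h (hKΩ hw)⟩

theorem cInfZeroOn_of_locally [FiniteDimensional ℝ E] {f : T × E → F} {Ω : Set (T × E)}
    (hΩ : IsOpen Ω)
    (h : ∀ z ∈ Ω, ∃ Ω', IsOpen Ω' ∧ z ∈ Ω' ∧ CInfZeroOn f Ω') : CInfZeroOn f Ω := by
  rw [cInfZeroOn_iff hΩ]
  constructor
  · intro t w hw
    obtain ⟨Ω', ho, hz, hf⟩ := h (t, w) hw
    exact ((hf.1 t).contDiffAt (slice_mem_nhds ho hz)).contDiffWithinAt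
  · intro n z hz
    obtain ⟨Ω', ho, hz, hf⟩ := h z hz
    exact ((((cInfZeroOn_iff ho).1 hf).2 n).continuousAt (ho.mem_nhds hz)).continuousWithinAt

end CnZero


/-! ### Integration against a continuous Haar system -/

namespace ContinuousLeftHaarSystem

variable {G G₀ : Type*} [TopologicalSpace G] [T2Space G] [SecondCountableTopology G]
  [MeasurableSpace G] [BorelSpace G] [TopologicalSpace G₀] [T2Space G₀]
  {𝒢 : ContinuousFamilyGroupoid G G₀} (𝓁 : ContinuousLeftHaarSystem 𝒢)
  {F : Type} [NormedAddCommGroup F] [NormedSpace ℝ F]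

/-- On a second countable space the complement of the support is null. Integrands thus matter only
on the fibre, outside which `g⁻¹ x` has no meaning. -/
theorem ae_r_eq (u : G₀) : ∀ᵐ g ∂(𝓁.lam u), 𝒢.r g = u := by
  have h := Measure.measure_compl_support (μ := 𝓁.lam u)
  rw [𝓁.support_eq] at h
  exact h

theorem isClosed_fiber (𝒢 : ContinuousFamilyGroupoid G G₀) (u : G₀) :
    IsClosed (𝒢.r ⁻¹' {u}) :=
  isClosed_singleton.preimage 𝒢.continuous_r

theorem aestronglyMeasurable {u : G₀} {f : G → F} (hf : ContinuousOn f (𝒢.r ⁻¹' {u})) :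
    AEStronglyMeasurable f (𝓁.lam u) := by
  have h : (𝓁.lam u).restrict (𝒢.r ⁻¹' {u}) = 𝓁.lam u :=
    Measure.restrict_eq_self_of_ae_mem (𝓁.ae_r_eq u)
  rw [← h]
  exact hf.aestronglyMeasurable (isClosed_fiber 𝒢 u).measurableSet

theorem integrable {u : G₀} {f : G → F} (hf : ContinuousOn f (𝒢.r ⁻¹' {u})) {C : Set G}
    (hC : IsCompact C) (h0 : ∀ g, 𝒢.r g = u → g ∉ C → f g = 0) : Integrable f (𝓁.lam u) := by
  have := 𝓁.regular u
  have h1 : IntegrableOn f (C ∩ 𝒢.r ⁻¹' {u}) (𝓁.lam u) := by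
    have hK := hC.inter_right (isClosed_fiber 𝒢 u)
    obtain ⟨M, hM⟩ := hK.exists_bound_of_continuousOn (hf.mono inter_subset_right)
    refine IntegrableOn.of_bound hK.measure_lt_top (𝓁.aestronglyMeasurable hf).restrict M ?_
    exact ae_restrict_of_forall_mem hK.measurableSet hM
  refine h1.integrable_of_ae_notMem_eq_zero ?_
  filter_upwards [𝓁.ae_r_eq u] with g hg hgC
  exact h0 g hg fun h => hgC ⟨h, hg⟩

/-- Replaces the varying measure by the fixed Lebesgue measure, the integrand being extended by
zero. If the chart does not meet the fibre over `u`, both sides vanish. -/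
theorem integral_eq_of_chart
    {φ : OpenPartialHomeomorph G (G₀ × EuclideanSpace ℝ (Fin 𝒢.familyR.dim))}
    (hφ : φ ∈ 𝒢.familyR.atlas)
    {ρ : G₀ × EuclideanSpace ℝ (Fin 𝒢.familyR.dim) → ℝ}
    (hρc : ContinuousOn ρ φ.target) (hρ0 : ∀ z ∈ φ.target, 0 ≤ ρ z) {u : G₀}
    (hρ : u ∈ 𝒢.r '' φ.source → ((𝓁.lam u).restrict φ.source).map (fun g => (φ g).2) =
          (volume.restrict {w | (u, w) ∈ φ.target}).withDensity
            (fun w => ENNReal.ofReal (ρ (u, w))))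
    {f : G → F} (hf : ContinuousOn f (𝒢.r ⁻¹' {u}))
    (h0 : ∀ g, 𝒢.r g = u → g ∉ φ.source → f g = 0) :
    ∫ g, f g ∂(𝓁.lam u) = ∫ v, {v | (u, v) ∈ φ.target}.indicator
      (fun v => ρ (u, v) • f (φ.symm (u, v))) v := by
  set V := {v | (u, v) ∈ φ.target} with hV
  have hVo : IsOpen V := φ.open_target.preimage (by fun_prop)
  have hr : ∀ v ∈ V, 𝒢.r (φ.symm (u, v)) = u := by
    intro v hv
    rw [← 𝒢.familyR.fst_chart φ hφ _ (φ.map_target hv), φ.right_inv hv]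
  by_cases hu : u ∈ 𝒢.r '' φ.source
  · have hsm : MeasurableSet φ.source := φ.open_source.measurableSet
    have hfc : ContinuousOn (fun v => f (φ.symm (u, v))) V :=
      hf.comp (φ.continuousOn_symm.comp (by fun_prop) fun v hv => hv) fun v hv => hr v hv
    calc ∫ g, f g ∂(𝓁.lam u) = ∫ g in φ.source, f g ∂(𝓁.lam u) := by
          refine (setIntegral_eq_integral_of_ae_compl_eq_zero ?_).symm
          filter_upwards [𝓁.ae_r_eq u] with g hg using h0 g hg
      _ = ∫ g in φ.source, f (φ.symm (u, (φ g).2)) ∂(𝓁.lam u) := by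
          refine setIntegral_congr_ae hsm ?_
          filter_upwards [𝓁.ae_r_eq u] with g hg hgs
          rw [← hg, ← 𝒢.familyR.fst_chart φ hφ g hgs]
          exact congrArg f (φ.left_inv hgs).symm
      _ = ∫ v, f (φ.symm (u, v)) ∂(((𝓁.lam u).restrict φ.source).map (fun g => (φ g).2)) := by
          refine (integral_map
            ((continuous_snd.comp_continuousOn φ.continuousOn).aemeasurable hsm)
            (f := fun v => f (φ.symm (u, v))) ?_).symm
          change AEStronglyMeasurable _ (((𝓁.lam u).restrict φ.source).map fun g => (φ g).2)
          rw [hρ hu]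
          exact (hfc.aestronglyMeasurable hVo.measurableSet).mono_ac
            (withDensity_absolutelyContinuous _ _)
      _ = ∫ v in V, (ENNReal.ofReal (ρ (u, v))).toReal • f (φ.symm (u, v)) := by
          rw [hρ hu]
          refine integral_withDensity_eq_integral_toReal_smul₀ ?_ (by simp) _
          have hc : ContinuousOn (fun v => ρ (u, v)) V := hρc.comp (by fun_prop) fun v hv => hv
          exact (hc.aemeasurable
            hVo.measurableSet).ennreal_ofReal
      _ = ∫ v in V, ρ (u, v) • f (φ.symm (u, v)) := by
          refine setIntegral_congr_fun hVo.measurableSet fun v hv => ?_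
          simp only [ENNReal.toReal_ofReal (hρ0 _ hv)]
      _ = _ := (integral_indicator hVo.measurableSet).symm
  · have hV0 : V = ∅ := by
      refine eq_empty_of_forall_notMem fun v hv => hu ⟨_, φ.map_target hv, hr v hv⟩
    rw [hV0]
    simp only [indicator_empty, integral_zero]
    refine integral_eq_zero_of_ae ?_
    filter_upwards [𝓁.ae_r_eq u] with g hg
    exact h0 g hg fun h => hu ⟨g, h, hg⟩

variable {W : Type*} [TopologicalSpace W]

theorem continuousOn_fiber {Ω : Set (G₀ × W)} {K : G × W → F}
    (hK : ContinuousOn K {z | (𝒢.r z.1, z.2) ∈ Ω}) {z : G₀ × W} (hz : z ∈ Ω) :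
    ContinuousOn (fun g => K (g, z.2)) (𝒢.r ⁻¹' {z.1}) := by
  refine hK.comp (by fun_prop) fun g hg => ?_
  rw [mem_preimage, mem_singleton_iff] at hg
  simpa [hg] using hz

theorem continuousOn_integral_of_chart
    {φ : OpenPartialHomeomorph G (G₀ × EuclideanSpace ℝ (Fin 𝒢.familyR.dim))}
    (hφ : φ ∈ 𝒢.familyR.atlas) {Ω : Set (G₀ × W)} (hΩ : IsOpen Ω) {K : G × W → F}
    (hK : ContinuousOn K {z | (𝒢.r z.1, z.2) ∈ Ω}) {C : Set G} (hC : IsCompact C)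
    (hCφ : C ⊆ φ.source) (h0 : ∀ g w, (𝒢.r g, w) ∈ Ω → g ∉ C → K (g, w) = 0) :
    ContinuousOn (fun z : G₀ × W => ∫ g, K (g, z.2) ∂(𝓁.lam z.1)) Ω := by
  obtain ⟨ρ, hρc, hρ0, hρ⟩ := 𝓁.density φ hφ
  have hr : ∀ y ∈ φ.target, 𝒢.r (φ.symm y) = y.1 := by
    intro y hy
    rw [← 𝒢.familyR.fst_chart φ hφ _ (φ.map_target hy), φ.right_inv hy]
  have key : ∀ z ∈ Ω, ∫ g, K (g, z.2) ∂(𝓁.lam z.1) =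
      ∫ v, {v | (z.1, v) ∈ φ.target}.indicator
        (fun v => ρ (z.1, v) • K (φ.symm (z.1, v), z.2)) v := fun z hz =>
    𝓁.integral_eq_of_chart hφ hρc hρ0 (fun hu => (hρ z.1 hu).1) (continuousOn_fiber hK hz)
      fun g hg hgs => h0 g z.2 (by simpa [hg] using hz) fun h => hgs (hCφ h)
  refine ContinuousOn.congr ?_ key
  have hzero : ∀ z ∈ Ω, ∀ v, (z.1, v) ∉ φ '' C → {v | (z.1, v) ∈ φ.target}.indicator
      (fun v => ρ (z.1, v) • K (φ.symm (z.1, v), z.2)) v = 0 := by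
    intro z hz v hv
    by_cases h : (z.1, v) ∈ φ.target
    · refine (indicator_of_mem (s := {v | (z.1, v) ∈ φ.target}) h _).trans ?_
      rw [h0 _ _ (by rw [hr _ h]; exact hz), smul_zero]
      exact fun hc => hv ⟨_, hc, φ.right_inv h⟩
    · exact indicator_of_notMem (s := {v | (z.1, v) ∈ φ.target}) h _
  have hφC : IsCompact (φ '' C) := hC.image_of_continuousOn (φ.continuousOn.mono hCφ)
  refine continuousOn_integral_of_compact_support (hφC.image continuous_snd) ?_ ?_
  · rintro ⟨z, v⟩ ⟨hz, -⟩
    by_cases h : (z.1, v) ∈ φ.target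
    · have hA : IsOpen {y : (G₀ × W) × EuclideanSpace ℝ (Fin 𝒢.familyR.dim) |
          y.1 ∈ Ω ∧ (y.1.1, y.2) ∈ φ.target} :=
        (hΩ.preimage continuous_fst).inter (φ.open_target.preimage (by fun_prop))
      have hc : ContinuousOn (fun y : (G₀ × W) × EuclideanSpace ℝ (Fin 𝒢.familyR.dim) =>
          ρ (y.1.1, y.2) • K (φ.symm (y.1.1, y.2), y.1.2))
          {y | y.1 ∈ Ω ∧ (y.1.1, y.2) ∈ φ.target} := by
        refine ContinuousOn.smul (hρc.comp (by fun_prop) fun y hy => hy.2)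
          (hK.comp (ContinuousOn.prodMk (φ.continuousOn_symm.comp (by fun_prop)
            fun y hy => hy.2) (by fun_prop)) fun y hy => ?_)
        simpa [hr _ hy.2] using hy.1
      refine ((hc.continuousAt (hA.mem_nhds ⟨hz, h⟩)).congr ?_).continuousWithinAt
      filter_upwards [hA.mem_nhds ⟨hz, h⟩] with y hy
      exact (indicator_of_mem (s := {v | (y.1.1, v) ∈ φ.target}) hy.2
        (fun v => ρ (y.1.1, v) • K (φ.symm (y.1.1, v), y.1.2))).symm
    -- Outside the chart target the density is not controlled, but `φ '' C` is closed, so the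
    -- extended integrand vanishes near such a point.
    · have hB : IsOpen {y : (G₀ × W) × EuclideanSpace ℝ (Fin 𝒢.familyR.dim) |
          y.1 ∈ Ω ∧ (y.1.1, y.2) ∉ φ '' C} :=
        (hΩ.preimage continuous_fst).inter (hφC.isClosed.isOpen_compl.preimage
          (by fun_prop : Continuous fun y : (G₀ × W) × EuclideanSpace ℝ (Fin 𝒢.familyR.dim) =>
            (y.1.1, y.2)))
      have hmem : (z, v) ∈ {y : (G₀ × W) × EuclideanSpace ℝ (Fin 𝒢.familyR.dim) |
          y.1 ∈ Ω ∧ (y.1.1, y.2) ∉ φ '' C} := by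
        refine ⟨hz, ?_⟩
        rintro ⟨g, hg, hgz⟩
        exact h (hgz ▸ φ.map_source (hCφ hg))
      refine (continuousAt_const (y := (0 : F)).congr ?_).continuousWithinAt
      filter_upwards [hB.mem_nhds hmem] with y hy
      exact (hzero y.1 hy.1 y.2 hy.2).symm
  · intro z v hz hv
    exact hzero z hz v fun h => hv ⟨_, h, rfl⟩

/-- Integrals against a continuous Haar system depend continuously on the base point and on
parameters. -/
theorem continuousOn_integral [LocallyCompactSpace G] {Ω : Set (G₀ × W)}
    (hΩ : IsOpen Ω) {K : G × W → F}
    (hK : ContinuousOn K {z | (𝒢.r z.1, z.2) ∈ Ω}) {C : Set G} (hC : IsCompact C)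
    (h0 : ∀ g w, (𝒢.r g, w) ∈ Ω → g ∉ C → K (g, w) = 0) :
    ContinuousOn (fun z : G₀ × W => ∫ g, K (g, z.2) ∂(𝓁.lam z.1)) Ω := by
  -- A partition of unity on `C`, subordinate to finitely many chart domains, reduces to integrands
  -- supported in one chart.
  obtain ⟨t, ht⟩ := hC.elim_finite_subcover
    (fun φ : 𝒢.familyR.atlas => φ.1.source) (fun φ => φ.1.open_source) fun g _ => by
      obtain ⟨φ, hφ, hg⟩ := 𝒢.familyR.covers g
      exact mem_iUnion.2 ⟨⟨φ, hφ⟩, hg⟩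
  have ht' : C ⊆ ⋃ i : Fin t.card, (t.equivFin.symm i).1.1.source := by
    intro g hg
    obtain ⟨φ, hφ, hgφ⟩ := mem_iUnion₂.1 (ht hg)
    refine mem_iUnion.2 ⟨t.equivFin ⟨φ, hφ⟩, ?_⟩
    simpa using hgφ
  obtain ⟨χ, hχs, hχ1, -, hχc⟩ := exists_continuous_sum_one_of_isOpen_isCompact
    (fun i => (t.equivFin.symm i).1.1.open_source) hC ht'
  have hKi : ∀ i, ContinuousOn (fun z : G × W => χ i z.1 • K z) {z | (𝒢.r z.1, z.2) ∈ Ω} :=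
    fun i => ContinuousOn.smul ((χ i).continuous.comp continuous_fst).continuousOn hK
  have hKi0 : ∀ i g w, (𝒢.r g, w) ∈ Ω → g ∉ tsupport (χ i) → χ i g • K (g, w) = 0 := by
    intro i g w _ hg
    rw [image_eq_zero_of_notMem_tsupport hg, zero_smul]
  have key : ∀ z ∈ Ω, ∫ g, K (g, z.2) ∂(𝓁.lam z.1) =
      ∑ i, ∫ g, χ i g • K (g, z.2) ∂(𝓁.lam z.1) := by
    intro z hz
    rw [← integral_finsetSum]
    · refine integral_congr_ae ?_
      filter_upwards [𝓁.ae_r_eq z.1] with g hg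
      by_cases hgC : g ∈ C
      · have := hχ1 hgC
        simp only [Finset.sum_apply, Pi.one_apply] at this
        rw [← Finset.sum_smul, this, one_smul]
      · simp [h0 g z.2 (by simpa [hg] using hz) hgC]
    · intro i _
      exact 𝓁.integrable (continuousOn_fiber (hKi i) hz) (hχc i)
        fun g hg => hKi0 i g z.2 (by simpa [hg] using hz)
  refine ContinuousOn.congr (continuousOn_finsetSum _ fun i _ => ?_) key
  exact 𝓁.continuousOn_integral_of_chart (t.equivFin.symm i).1.2 hΩ (hKi i) (hχc i) (hχs i)
    (hKi0 i)

end ContinuousLeftHaarSystem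

/-! ### Differentiation under the integral sign -/

namespace ContinuousLeftHaarSystem

variable {G G₀ : Type*} [TopologicalSpace G] [T2Space G] [SecondCountableTopology G]
  [LocallyCompactSpace G] [MeasurableSpace G] [BorelSpace G] [TopologicalSpace G₀] [T2Space G₀]
  {𝒢 : ContinuousFamilyGroupoid G G₀} (𝓁 : ContinuousLeftHaarSystem 𝒢)
  {F : Type} [NormedAddCommGroup F] [NormedSpace ℝ F]
  {E : Type} [NormedAddCommGroup E] [NormedSpace ℝ E] [FiniteDimensional ℝ E]

theorem hasFDerivAt_integral {Ω : Set (G₀ × E)} (hΩ : IsOpen Ω) {K : G × E → F}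
    {K' : G × E → E →L[ℝ] F}
    (hK : ContinuousOn K {z | (𝒢.r z.1, z.2) ∈ Ω}) {C : Set G} (hC : IsCompact C)
    (h0 : ∀ g w, (𝒢.r g, w) ∈ Ω → g ∉ C → K (g, w) = 0)
    (hK' : ContinuousOn K' {z | (𝒢.r z.1, z.2) ∈ Ω})
    (h0' : ∀ g w, (𝒢.r g, w) ∈ Ω → g ∉ C → K' (g, w) = 0)
    (hd : ∀ z, (𝒢.r z.1, z.2) ∈ Ω → HasFDerivAt (fun w => K (z.1, w)) (K' z) z.2)
    {z : G₀ × E} (hz : z ∈ Ω) :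
    HasFDerivAt (fun w => ∫ g, K (g, w) ∂(𝓁.lam z.1)) (∫ g, K' (g, z.2) ∂(𝓁.lam z.1)) z.2 := by
  have := 𝓁.regular z.1
  have : ProperSpace E := FiniteDimensional.proper ℝ E
  obtain ⟨u, w⟩ := z
  obtain ⟨ε, hε, hεΩ⟩ := Metric.nhds_basis_closedBall.mem_iff.1 (slice_mem_nhds hΩ hz)
  have hsub : ∀ x ∈ Metric.closedBall w ε, ∀ g, 𝒢.r g = u → (𝒢.r g, x) ∈ Ω := by
    rintro x hx g rfl
    exact hεΩ hx
  have hcomp : IsCompact ((C ∩ 𝒢.r ⁻¹' {u}) ×ˢ Metric.closedBall w ε) :=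
    (hC.inter_right (isClosed_fiber 𝒢 u)).prod (isCompact_closedBall w ε)
  -- The dominating function is `M` on `C` and zero elsewhere; it is integrable because regular
  -- measures are finite on compact sets.
  obtain ⟨M, hM⟩ := hcomp.exists_bound_of_continuousOn (f := K')
    (hK'.mono fun y hy => hsub _ hy.2 _ hy.1.2)
  refine hasFDerivAt_integral_of_dominated_of_fderiv_le (𝕜 := ℝ)
    (F := fun w g => K (g, w)) (F' := fun w g => K' (g, w)) (Metric.closedBall_mem_nhds w hε)
    (bound := C.indicator fun _ => M) ?_ ?_ ?_ ?_ ?_ ?_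
  · filter_upwards [Metric.closedBall_mem_nhds w hε] with x hx
    exact 𝓁.aestronglyMeasurable (continuousOn_fiber hK (z := (u, x)) (hεΩ hx))
  · exact 𝓁.integrable (continuousOn_fiber hK hz) hC fun g hg => h0 g w (by simpa [hg] using hz)
  · exact 𝓁.aestronglyMeasurable (continuousOn_fiber hK' hz)
  · filter_upwards [𝓁.ae_r_eq u] with g hg x hx
    by_cases hgC : g ∈ C
    · rw [indicator_of_mem hgC]
      exact hM (g, x) ⟨⟨hgC, hg⟩, hx⟩
    · rw [indicator_of_notMem hgC, h0' g x (hsub x hx g hg) hgC, norm_zero]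
  · rw [integrable_indicator_iff hC.measurableSet]
    exact integrableOn_const hC.measure_lt_top.ne
  · filter_upwards [𝓁.ae_r_eq u] with g hg x hx
    exact hd (g, x) (hsub x hx g hg)

theorem cnZeroOn_integral {n : ℕ} {Ω : Set (G₀ × E)} (hΩ : IsOpen Ω) {K : G × E → F}
    (hK : CnZeroOn n K {z | (𝒢.r z.1, z.2) ∈ Ω}) {C : Set G} (hC : IsCompact C)
    (h0 : ∀ g w, (𝒢.r g, w) ∈ Ω → g ∉ C → K (g, w) = 0) :
    CnZeroOn n (fun z : G₀ × E => ∫ g, K (g, z.2) ∂(𝓁.lam z.1)) Ω := by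
  induction n generalizing F with
  | zero => exact 𝓁.continuousOn_integral hΩ hK hC h0
  | succ n ih =>
    obtain ⟨hc, K', hd, hK'⟩ := hK
    -- For `g ∉ C` the integrand is zero on an open set of `w`, so the same `C` serves for every
    -- derivative.
    have h0' : ∀ g w, (𝒢.r g, w) ∈ Ω → g ∉ C → K' (g, w) = 0 := by
      intro g w hw hg
      refine (hd (g, w) hw).unique ((hasFDerivAt_const (0 : F) w).congr_of_eventuallyEq ?_)
      filter_upwards [slice_mem_nhds hΩ hw] with x hx using h0 g x hx hg
    exact ⟨𝓁.continuousOn_integral hΩ hc hC h0, _,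
      fun z hz => 𝓁.hasFDerivAt_integral hΩ hc hC h0 hK'.continuousOn h0' hd hz, ih hK' h0'⟩

/-- Integration along the fibres of a function with compact support in the direction of the
fibres preserves the class `C^{∞,0}`. -/
theorem cInfZeroOn_integral {Ω : Set (G₀ × E)} (hΩ : IsOpen Ω) {K : G × E → F}
    (hK : CInfZeroOn K {z | (𝒢.r z.1, z.2) ∈ Ω}) {C : Set G} (hC : IsCompact C)
    (h0 : ∀ g w, (𝒢.r g, w) ∈ Ω → g ∉ C → K (g, w) = 0) :
    CInfZeroOn (fun z : G₀ × E => ∫ g, K (g, z.2) ∂(𝓁.lam z.1)) Ω := by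
  have hΩ' : IsOpen {z : G × E | (𝒢.r z.1, z.2) ∈ Ω} :=
    hΩ.preimage ((𝒢.continuous_r.comp continuous_fst).prodMk continuous_snd)
  rw [cInfZeroOn_iff_forall_cnZeroOn hΩ'] at hK
  exact (cInfZeroOn_iff_forall_cnZeroOn hΩ).2 fun n => 𝓁.cnZeroOn_integral hΩ (hK n) hC h0

end ContinuousLeftHaarSystem

/-! ### Functions of class `C^{∞,0}` on continuous families -/

section Families

variable {X T : Type*} [TopologicalSpace X] [TopologicalSpace T] {p : X → T}
  {𝓕 : ContinuousFamily p}

theorem ContinuousFamily.fst_eq (𝓕 : ContinuousFamily p) {φ} (hφ : φ ∈ 𝓕.atlas)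
    {z : T × EuclideanSpace ℝ (Fin 𝓕.dim)} (hz : z ∈ φ.target) : p (φ.symm z) = z.1 := by
  rw [← 𝓕.fst_chart φ hφ _ (φ.map_target hz), φ.right_inv hz]

/-- Continuity need not be checked separately: it is order zero of the condition in charts, which
are homeomorphisms. -/
theorem isCInfZero_of_locally {f : X → ℝ}
    (h : ∀ x, ∃ O, IsOpen O ∧ x ∈ O ∧ ∀ φ ∈ 𝓕.atlas,
      CInfZeroOn (fun z => f (φ.symm z)) (φ.target ∩ φ.symm ⁻¹' O)) : IsCInfZero 𝓕 f := by
  constructor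
  · rw [continuous_iff_continuousAt]
    intro x
    obtain ⟨O, hO, hxO, hf⟩ := h x
    obtain ⟨φ, hφ, hx⟩ := 𝓕.covers x
    have ho := φ.isOpen_inter_preimage_symm hO
    have h1 : ContinuousAt (fun z => f (φ.symm z)) (φ x) :=
      (((cInfZeroOn_iff_forall_cnZeroOn ho).1 (hf φ hφ) 0).continuousOn).continuousAt
        (ho.mem_nhds ⟨φ.map_source hx, by simpa [φ.left_inv hx] using hxO⟩)
    refine (ContinuousAt.comp h1 (φ.continuousAt hx)).congr ?_
    filter_upwards [φ.open_source.mem_nhds hx] with y hy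
    simp [φ.left_inv hy]
  · intro φ hφ
    refine cInfZeroOn_of_locally φ.open_target fun z hz => ?_
    obtain ⟨O, hO, hxO, hf⟩ := h (φ.symm z)
    exact ⟨_, φ.isOpen_inter_preimage_symm hO, ⟨hz, hxO⟩, hf φ hφ⟩

theorem isCInfZero_of_charts {f : X → ℝ}
    (h : ∀ φ ∈ 𝓕.atlas, CInfZeroOn (fun z => f (φ.symm z)) φ.target) : IsCInfZero 𝓕 f :=
  isCInfZero_of_locally fun x => ⟨univ, isOpen_univ, mem_univ x, fun φ hφ => by
    simpa using h φ hφ⟩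

namespace IsCInfZero

theorem cnZeroOn {f : X → ℝ} (hf : IsCInfZero 𝓕 f) {φ} (hφ : φ ∈ 𝓕.atlas) (n : ℕ) :
    CnZeroOn n (fun z => f (φ.symm z)) φ.target :=
  (cInfZeroOn_iff_forall_cnZeroOn φ.open_target).1 (hf.2 φ hφ) n

theorem of_cnZeroOn {f : X → ℝ}
    (h : ∀ φ ∈ 𝓕.atlas, ∀ n : ℕ, CnZeroOn n (fun z => f (φ.symm z)) φ.target) :
    IsCInfZero 𝓕 f :=
  isCInfZero_of_charts fun φ hφ => (cInfZeroOn_iff_forall_cnZeroOn φ.open_target).2 (h φ hφ)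

theorem const (c : ℝ) : IsCInfZero 𝓕 fun _ => c :=
  of_cnZeroOn fun _ _ _ => CnZeroOn.of_fst (c := fun _ => c) continuousOn_const

theorem add {f g : X → ℝ} (hf : IsCInfZero 𝓕 f) (hg : IsCInfZero 𝓕 g) :
    IsCInfZero 𝓕 fun x => f x + g x :=
  of_cnZeroOn fun _ hφ n => (hf.cnZeroOn hφ n).add (hg.cnZeroOn hφ n)

theorem mul {f g : X → ℝ} (hf : IsCInfZero 𝓕 f) (hg : IsCInfZero 𝓕 g) :
    IsCInfZero 𝓕 fun x => f x * g x :=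
  of_cnZeroOn fun _ hφ n => (hf.cnZeroOn hφ n).mul (hg.cnZeroOn hφ n)

theorem smooth_comp {f : X → ℝ} (hf : IsCInfZero 𝓕 f) {b : ℝ → ℝ} {s : Set ℝ} (hs : IsOpen s)
    (hb : ContDiffOn ℝ ∞ b s) (hfs : ∀ x, f x ∈ s) : IsCInfZero 𝓕 fun x => b (f x) :=
  of_cnZeroOn fun φ hφ n => CnZeroOn.smooth_comp hs (hb.of_le (by exact_mod_cast le_top))
    φ.open_target (hf.cnZeroOn hφ n) fun _ _ => hfs _

theorem sum {ι : Type*} (s : Finset ι) {f : ι → X → ℝ} (hf : ∀ i ∈ s, IsCInfZero 𝓕 (f i)) :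
    IsCInfZero 𝓕 fun x => ∑ i ∈ s, f i x := by
  classical
  induction s using Finset.induction_on with
  | empty => simpa using const 0
  | insert i s hi ih =>
    simp only [Finset.sum_insert hi]
    exact (hf i (by simp)).add (ih fun j hj => hf j (by simp [hj]))

theorem prod {ι : Type*} (s : Finset ι) {f : ι → X → ℝ} (hf : ∀ i ∈ s, IsCInfZero 𝓕 (f i)) :
    IsCInfZero 𝓕 fun x => ∏ i ∈ s, f i x := by
  classical
  induction s using Finset.induction_on with
  | empty => simpa using const 1
  | insert i s hi ih =>
    simp only [Finset.prod_insert hi]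
    exact (hf i (by simp)).mul (ih fun j hj => hf j (by simp [hj]))

theorem of_eventuallyEq {f : X → ℝ} (h : ∀ x, ∃ g, IsCInfZero 𝓕 g ∧ f =ᶠ[𝓝 x] g) :
    IsCInfZero 𝓕 f := by
  refine isCInfZero_of_locally fun x => ?_
  obtain ⟨g, hg, hfg⟩ := h x
  obtain ⟨O, hO, ho, hx⟩ := eventually_nhds_iff.1 hfg
  refine ⟨O, ho, hx, fun φ hφ => ?_⟩
  exact ((hg.2 φ hφ).mono inter_subset_left).congr (φ.isOpen_inter_preimage_symm ho)
    fun z hz => hO _ hz.2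

theorem finsum {ι : Type*} {f : ι → X → ℝ} (hf : ∀ i, IsCInfZero 𝓕 (f i))
    (hl : LocallyFinite fun i => Function.support (f i)) :
    IsCInfZero 𝓕 fun x => ∑ᶠ i, f i x := by
  refine of_eventuallyEq fun x => ?_
  obtain ⟨O, hO, hfin⟩ := hl x
  refine ⟨_, sum hfin.toFinset fun i _ => hf i, ?_⟩
  filter_upwards [hO] with y hy
  refine finsum_eq_sum_of_support_subset _ fun i hi => ?_
  simpa using ⟨y, hi, hy⟩

theorem comp_morphism {X' T' : Type*} [TopologicalSpace X'] [TopologicalSpace T'] {p' : X' → T'}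
    {𝓕' : ContinuousFamily p'} {f : X → X'} {q : T → T'} (hf : IsMorphism 𝓕 𝓕' f q)
    {h : X' → ℝ} (hh : IsCInfZero 𝓕' h) : IsCInfZero 𝓕 fun x => h (f x) := by
  obtain ⟨hfc, hqc, hpq, hmor⟩ := hf
  refine isCInfZero_of_charts fun φ hφ => cInfZeroOn_of_locally φ.open_target fun z hz => ?_
  obtain ⟨ψ, hψ, hx⟩ := 𝓕'.covers (f (φ.symm z))
  have ho := φ.isOpen_inter_preimage_symm (ψ.open_source.preimage hfc)
  refine ⟨_, ho, ⟨hz, hx⟩, (cInfZeroOn_iff_forall_cnZeroOn ho).2 fun n => ?_⟩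
  have heq : ∀ y ∈ φ.target ∩ φ.symm ⁻¹' (f ⁻¹' ψ.source),
      (q y.1, (ψ (f (φ.symm y))).2) = ψ (f (φ.symm y)) := by
    intro y hy
    refine Prod.ext ?_ rfl
    simp only
    rw [𝓕'.fst_chart ψ hψ _ hy.2, hpq, 𝓕.fst_eq hφ hy.1]
  refine (CnZeroOn.comp (hh.cnZeroOn hψ n) (q := fun y => q y.1) (by fun_prop) ho
    (fun _ _ _ _ => rfl) ((cInfZeroOn_iff_forall_cnZeroOn ho).1 (hmor φ hφ ψ hψ) n)
    fun y hy => ?_).congr ho fun y hy => ?_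
  · rw [heq y hy]
    exact ψ.map_source hy.2
  · rw [heq y hy, ψ.left_inv hy.2]

end IsCInfZero

/-- In a chart, the product of a continuous cutoff in the base and a smooth bump in the fibre,
extended by zero. No smoothness is required in the base direction. -/
theorem ContinuousFamily.exists_bump [T2Space X] [T2Space T] [LocallyCompactSpace T]
    (𝓕 : ContinuousFamily p) {U : Set X} (hU : IsOpen U) {y : X} (hy : y ∈ U) :
    ∃ h : X → ℝ, IsCInfZero 𝓕 h ∧ (∀ x, 0 ≤ h x) ∧ HasCompactSupport h ∧ tsupport h ⊆ U ∧
      0 < h y := by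
  obtain ⟨φ, hφ, hyφ⟩ := 𝓕.covers y
  obtain ⟨A, B, hA, hB, htA, hwB, hAB⟩ := isOpen_prod_iff.1 (φ.isOpen_inter_preimage_symm hU)
    (φ y).1 (φ y).2 ⟨φ.map_source hyφ, by simpa [φ.left_inv hyφ] using hy⟩
  obtain ⟨N, hN, htN, hNA⟩ := exists_compact_subset hA htA
  obtain ⟨ε, hε, hεB⟩ := Metric.nhds_basis_closedBall.mem_iff.1 (hB.mem_nhds hwB)
  obtain ⟨χ, hχ1, hχ0, -, hχ01⟩ := exists_continuous_one_zero_of_isCompact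
    (isCompact_singleton (x := (φ y).1)) isOpen_interior.isClosed_compl
    (t := (interior N)ᶜ) (by simpa using htN)
  let b : ContDiffBump (φ y).2 := ⟨ε / 2, ε, by positivity, by linarith⟩
  have hK : IsCompact (φ.symm '' (N ×ˢ Metric.closedBall (φ y).2 ε)) :=
    (hN.prod (isCompact_closedBall _ _)).image_of_continuousOn
      (φ.continuousOn_symm.mono fun z hz => (hAB ⟨hNA hz.1, hεB hz.2⟩).1)
  set K := φ.symm '' (N ×ˢ Metric.closedBall (φ y).2 ε) with hKdef
  have hKφ : K ⊆ φ.source := by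
    rintro _ ⟨z, hz, rfl⟩
    exact φ.map_target (hAB ⟨hNA hz.1, hεB hz.2⟩).1
  have hKU : K ⊆ U := by
    rintro _ ⟨z, hz, rfl⟩
    exact (hAB ⟨hNA hz.1, hεB hz.2⟩).2
  set h : X → ℝ := φ.source.indicator fun x => χ (φ x).1 * b (φ x).2 with hh
  have h0 : ∀ x ∉ K, h x = 0 := by
    intro x hx
    by_cases hxφ : x ∈ φ.source
    · rw [hh, indicator_of_mem hxφ]
      by_contra hne
      refine hx ⟨φ x, ⟨?_, ?_⟩, φ.left_inv hxφ⟩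
      · by_contra hc
        exact left_ne_zero_of_mul hne (hχ0 fun h => hc (interior_subset h))
      · have : (φ x).2 ∈ Function.support b := right_ne_zero_of_mul hne
        rw [b.support_eq] at this
        exact Metric.ball_subset_closedBall this
    · exact indicator_of_notMem hxφ _
  have hts : tsupport h ⊆ K := closure_minimal (fun x hx => by
    by_contra hc
    exact hx (h0 x hc)) hK.isClosed
  refine ⟨h, isCInfZero_of_locally fun x => ?_, fun x => ?_,
    hK.of_isClosed_subset (isClosed_tsupport _) hts, hts.trans hKU, ?_⟩
  -- The chart domain and the complement of the compact `K` form an open cover: on the first use the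
  -- formula, on the second `h` is zero.
  · by_cases hx : x ∈ φ.source
    · refine ⟨φ.source, φ.open_source, hx, fun ψ hψ => ?_⟩
      have ho := ψ.isOpen_inter_preimage_symm φ.open_source
      refine (cInfZeroOn_iff_forall_cnZeroOn ho).2 fun n => ?_
      have h1 : CnZeroOn n (fun z : T × EuclideanSpace ℝ (Fin 𝓕.dim) => χ z.1)
          (ψ.target ∩ ψ.symm ⁻¹' φ.source) :=
        CnZeroOn.of_fst (c := χ) (by fun_prop)
      have h2 := CnZeroOn.smooth_comp (n := n) isOpen_univ
        (b.contDiff (n := n)).contDiffOn ho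
        ((cInfZeroOn_iff_forall_cnZeroOn ho).1 (𝓕.compatible ψ hψ φ hφ) n) fun _ _ => mem_univ _
      refine (h1.mul h2).congr ho fun z hz => ?_
      rw [hh, indicator_of_mem (by exact hz.2), 𝓕.fst_chart φ hφ _ hz.2, 𝓕.fst_eq hψ hz.1]
    · refine ⟨Kᶜ, hK.isClosed.isOpen_compl, fun h => hx (hKφ h), fun ψ hψ => ?_⟩
      exact (((IsCInfZero.const (𝓕 := 𝓕) 0).2 ψ hψ).mono inter_subset_left).congr
        (ψ.isOpen_inter_preimage_symm hK.isClosed.isOpen_compl) fun z hz => h0 _ hz.2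
  · exact indicator_nonneg (fun x _ => mul_nonneg (hχ01 _).1 b.nonneg) x
  · rw [hh, indicator_of_mem hyφ, hχ1 rfl]
    simpa using b.pos_of_mem_ball (Metric.mem_ball_self hε)

end Families

/-! ### Averages along the orbits of a proper `G`-space -/

theorem TopologicalGroupoid.inv_inv {G G₀ : Type*} [TopologicalSpace G] [TopologicalSpace G₀]
    (𝒢 : TopologicalGroupoid G G₀) (g : G) : 𝒢.inv (𝒢.inv g) = g := by
  calc 𝒢.inv (𝒢.inv g) = 𝒢.mul (𝒢.inv (𝒢.inv g)) (𝒢.mul (𝒢.inv g) g) := by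
        conv_lhs => rw [← 𝒢.mul_unit (𝒢.inv (𝒢.inv g)), 𝒢.s_inv, 𝒢.r_inv, ← 𝒢.inv_mul]
    _ = 𝒢.mul (𝒢.mul (𝒢.inv (𝒢.inv g)) (𝒢.inv g)) g :=
        (𝒢.mul_assoc _ _ _ (𝒢.s_inv _) (𝒢.s_inv _)).symm
    _ = g := by rw [𝒢.inv_mul, 𝒢.s_inv, 𝒢.unit_mul]

namespace CInfZeroGSpace

section Algebra

variable {G G₀ X : Type*} [TopologicalSpace G] [TopologicalSpace G₀] [TopologicalSpace X]
  {𝒢 : ContinuousFamilyGroupoid G G₀} {p : X → G₀} (𝒳 : CInfZeroGSpace 𝒢 p)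

theorem proj_inv_act {g : G} {x : X} (h : 𝒢.r g = p x) : p (𝒳.act (𝒢.inv g) x) = 𝒢.s g := by
  rw [𝒳.proj_act _ _ (by rw [𝒢.s_inv, h]), 𝒢.r_inv]

theorem act_inv_act {g : G} {x : X} (h : 𝒢.r g = p x) :
    𝒳.act g (𝒳.act (𝒢.inv g) x) = x := by
  have := 𝒳.inv_act (𝒢.inv g) x (by rw [𝒢.s_inv, h])
  rwa [𝒢.inv_inv] at this

/-- Since `x = k (k⁻¹ x)`, one has `g x = (g k) (k⁻¹ x)`. This is the substitution that makes
averages invariant. -/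
theorem inv_mul_act {g k : G} {x : X} (hg : 𝒢.s g = p x) (hk : 𝒢.s g = 𝒢.r k) :
    𝒳.act (𝒢.inv (𝒢.mul g k)) (𝒳.act g x) = 𝒳.act (𝒢.inv k) x := by
  have hkx : 𝒢.r k = p x := hk ▸ hg
  have hy := 𝒳.proj_inv_act hkx
  conv_lhs => rw [← 𝒳.act_inv_act hkx, 𝒳.act_act _ _ _ hk hy.symm]
  exact 𝒳.inv_act _ _ (by rw [𝒢.s_mul _ _ hk, hy])

/-- Project the compact preimage of `K ×ˢ L` to `G` and invert. The point is that `C` is uniform in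
`x ∈ L`. -/
theorem IsProper.exists_compact {𝒳 : CInfZeroGSpace 𝒢 p} (h : 𝒳.IsProper) {K L : Set X}
    (hK : IsCompact K) (hL : IsCompact L) : ∃ C : Set G, IsCompact C ∧
      ∀ g, ∀ x ∈ L, 𝒢.r g = p x → 𝒳.act (𝒢.inv g) x ∈ K → g ∈ C := by
  refine ⟨_, ((h _ (hK.prod hL)).image (continuous_subtype_val.fst)).image 𝒢.continuous_inv,
    fun g x hx hg hgx => ⟨𝒢.inv g, ⟨⟨(𝒢.inv g, x), ?_⟩, ⟨hgx, hx⟩, rfl⟩, 𝒢.inv_inv g⟩⟩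
  simp only [𝒢.s_inv, hg]

theorem continuousOn_inv_act (x : X) :
    ContinuousOn (fun g => 𝒳.act (𝒢.inv g) x) (𝒢.r ⁻¹' {p x}) := by
  refine 𝒳.continuous_act.comp (f := fun g => (𝒢.inv g, x))
    (𝒢.continuous_inv.prodMk continuous_const).continuousOn fun g hg => ?_
  exact (𝒢.s_inv g).trans hg

/-- Here `g` is a base parameter, so only continuity of inversion is needed to pull back from `s` to
`r`. -/
theorem cInfZeroOn_inv_act {f : X → ℝ} (hf : IsCInfZero 𝒳.family f) {φ}
    (hφ : φ ∈ 𝒳.family.atlas) :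
    CInfZeroOn (fun z : G × EuclideanSpace ℝ (Fin 𝒳.family.dim) =>
      f (𝒳.act (𝒢.inv z.1) (φ.symm (𝒢.r z.1, z.2)))) {z | (𝒢.r z.1, z.2) ∈ φ.target} := by
  have h1 := (hf.comp_morphism 𝒳.act_morphism).2 _ ⟨φ, hφ, rfl⟩
  have ho : IsOpen (pullbackChart 𝒢.s 𝒳.family 𝒢.continuous_s φ hφ).target :=
    (pullbackChart 𝒢.s 𝒳.family 𝒢.continuous_s φ hφ).open_target
  have h2 : CInfZeroOn (fun z : G × EuclideanSpace ℝ (Fin 𝒳.family.dim) =>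
      f (𝒳.act z.1 (φ.symm (𝒢.s z.1, z.2)))) {z | (𝒢.s z.1, z.2) ∈ φ.target} := by
    refine CInfZeroOn.congr ho h1 fun z hz => ?_
    have := pullbackChart_symm_val 𝒢.s 𝒳.family 𝒢.continuous_s φ hφ z hz
    exact congrArg (fun y : G × X => f (𝒳.act y.1 y.2)) this.symm
  simpa only [𝒢.s_inv, mem_ofPred_eq] using h2.pullback 𝒢.continuous_inv

end Algebra

variable {G G₀ X : Type*} [TopologicalSpace G] [T2Space G] [LocallyCompactSpace G]
  [SecondCountableTopology G] [MeasurableSpace G] [BorelSpace G]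
  [TopologicalSpace G₀] [T2Space G₀] [TopologicalSpace X]
  {𝒢 : ContinuousFamilyGroupoid G G₀} {p : X → G₀} {𝒳 : CInfZeroGSpace 𝒢 p}

/-- The average of `f` along the orbits: `x ↦ ∫ f (g⁻¹ x) dλ^{p x}(g)`. -/
noncomputable def average (𝒳 : CInfZeroGSpace 𝒢 p) (𝓁 : ContinuousLeftHaarSystem 𝒢)
    (f : X → ℝ) (x : X) : ℝ :=
  ∫ g, f (𝒳.act (𝒢.inv g) x) ∂(𝓁.lam (p x))

variable (𝓁 : ContinuousLeftHaarSystem 𝒢) {f : X → ℝ}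

theorem integrable_inv_act (h𝒳 : 𝒳.IsProper) (hf : Continuous f) (hfc : HasCompactSupport f)
    (x : X) : Integrable (fun g => f (𝒳.act (𝒢.inv g) x)) (𝓁.lam (p x)) := by
  obtain ⟨C, hC, hCm⟩ := h𝒳.exists_compact hfc (isCompact_singleton (x := x))
  refine 𝓁.integrable (hf.comp_continuousOn (𝒳.continuousOn_inv_act x)) hC fun g hg hgC => ?_
  exact image_eq_zero_of_notMem_tsupport fun h => hgC (hCm g x rfl hg h)

theorem average_nonneg (hf : ∀ x, 0 ≤ f x) (x : X) : 0 ≤ 𝒳.average 𝓁 f x :=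
  integral_nonneg fun _ => hf _

/-- The integrand is positive on a relatively open part of the fibre, which has positive measure
because the support of `λ^{p x}` is the whole fibre. -/
theorem average_pos (h𝒳 : 𝒳.IsProper) (hf : Continuous f) (hfc : HasCompactSupport f)
    (hf0 : ∀ x, 0 ≤ f x) {g : G} {x : X} (hg : 𝒢.r g = p x)
    (hfg : 0 < f (𝒳.act (𝒢.inv g) x)) : 0 < 𝒳.average 𝓁 f x := by
  refine (integral_pos_iff_support_of_nonneg_ae (ae_of_all _ fun _ => hf0 _)
    (integrable_inv_act 𝓁 h𝒳 hf hfc x)).2 ?_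
  obtain ⟨O, hO, hOs⟩ := (continuousOn_iff'.1
    (hf.comp_continuousOn (𝒳.continuousOn_inv_act x))) (Ioi 0) isOpen_Ioi
  have hgO : g ∈ O := by
    have : g ∈ O ∩ 𝒢.r ⁻¹' {p x} := hOs ▸ ⟨hfg, hg⟩
    exact this.1
  have hgs : g ∈ (𝓁.lam (p x)).support := by
    rw [𝓁.support_eq]; exact hg
  refine ((Measure.mem_support_iff_forall _).1 hgs O (hO.mem_nhds hgO)).trans_le ?_
  refine measure_mono_ae ?_
  filter_upwards [𝓁.ae_r_eq (p x)] with k hk hkO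
  have : k ∈ (f ∘ fun g => 𝒳.act (𝒢.inv g) x) ⁻¹' Ioi 0 ∩ 𝒢.r ⁻¹' {p x} := hOs.symm ▸ ⟨hkO, hk⟩
  exact (show 0 < f (𝒳.act (𝒢.inv k) x) from this.1).ne'

theorem average_mul {θ : X → ℝ} (hθ : ∀ g x, 𝒢.s g = p x → θ (𝒳.act g x) = θ x) (x : X) :
    𝒳.average 𝓁 (fun y => θ y * f y) x = θ x * 𝒳.average 𝓁 f x := by
  rw [average, average, ← integral_const_mul]
  refine integral_congr_ae ?_
  filter_upwards [𝓁.ae_r_eq (p x)] with g hg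
  rw [hθ _ _ (by rw [𝒢.s_inv, hg])]

/-- Averages are constant along the orbits. -/
theorem average_act (h𝒳 : 𝒳.IsProper) (hf : Continuous f) (hfc : HasCompactSupport f)
    {g : G} {x : X} (hg : 𝒢.s g = p x) : 𝒳.average 𝓁 f (𝒳.act g x) = 𝒳.average 𝓁 f x := by
  have hp := 𝒳.proj_act g x hg
  obtain ⟨C, hC, hCm⟩ := h𝒳.exists_compact hfc (isCompact_singleton (x := 𝒳.act g x))
  have hcl := ContinuousLeftHaarSystem.isClosed_fiber 𝒢 (𝒢.r g)
  have hcont : ContinuousOn (fun k => f (𝒳.act (𝒢.inv k) (𝒳.act g x))) (𝒢.r ⁻¹' {𝒢.r g}) :=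
    hf.comp_continuousOn (hp ▸ 𝒳.continuousOn_inv_act (𝒳.act g x))
  -- Invariance is available only for functions in `C_c(G)`, whereas the integrand is continuous
  -- only on a closed fibre: extend it by Tietze and cut off by a `χ` equal to one on `C`.
  obtain ⟨e, he⟩ := ContinuousMap.exists_restrict_eq hcl ⟨_, hcont.domRestrict⟩
  obtain ⟨χ, hχ1, -, hχc, -⟩ := exists_continuous_one_zero_of_isCompact hC isClosed_empty
    (disjoint_empty C)
  have hF : ∀ k, 𝒢.r k = 𝒢.r g → χ k * e k = f (𝒳.act (𝒢.inv k) (𝒳.act g x)) := by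
    intro k hk
    have h1 : e k = f (𝒳.act (𝒢.inv k) (𝒳.act g x)) :=
      congrArg (fun c : C(𝒢.r ⁻¹' {𝒢.r g}, ℝ) => c ⟨k, hk⟩) he
    by_cases hkC : k ∈ C
    · rw [hχ1 hkC, h1, Pi.one_apply, one_mul]
    · have : f (𝒳.act (𝒢.inv k) (𝒳.act g x)) = 0 :=
        image_eq_zero_of_notMem_tsupport fun h => hkC (hCm k _ rfl (hk.trans hp.symm) h)
      rw [h1, this, mul_zero]
  have hinv := 𝓁.invariant g (fun k => χ k * e k) (by fun_prop) hχc.mul_right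
  rw [average, average, hp, ← hg]
  calc ∫ k, f (𝒳.act (𝒢.inv k) (𝒳.act g x)) ∂(𝓁.lam (𝒢.r g))
      = ∫ k, χ k * e k ∂(𝓁.lam (𝒢.r g)) := by
        refine integral_congr_ae ?_
        filter_upwards [𝓁.ae_r_eq (𝒢.r g)] with k hk using (hF k hk).symm
    _ = ∫ k, χ (𝒢.mul g k) * e (𝒢.mul g k) ∂(𝓁.lam (𝒢.s g)) := hinv.symm
    _ = _ := by
        refine integral_congr_ae ?_
        filter_upwards [𝓁.ae_r_eq (𝒢.s g)] with k hk
        rw [hF _ (𝒢.r_mul _ _ hk.symm), 𝒳.inv_mul_act hg hk.symm]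

/-- The average of a function in `C_c^{∞,0}(X)` is of class `C^{∞,0}`. -/
theorem isCInfZero_average [LocallyCompactSpace G₀] (h𝒳 : 𝒳.IsProper)
    (hf : IsCInfZero 𝒳.family f) (hfc : HasCompactSupport f) :
    IsCInfZero 𝒳.family (𝒳.average 𝓁 f) := by
  refine isCInfZero_of_charts fun φ hφ => cInfZeroOn_of_locally φ.open_target fun z hz => ?_
  -- A compact neighbourhood lets properness supply one `C` for all nearby points.
  obtain ⟨N, hN, hzN, hNφ⟩ := exists_compact_subset φ.open_target hz
  obtain ⟨C, hC, hCm⟩ := h𝒳.exists_compact hfc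
    (hN.image_of_continuousOn (φ.continuousOn_symm.mono hNφ))
  have hsub : interior N ⊆ φ.target := interior_subset.trans hNφ
  refine ⟨interior N, isOpen_interior, hzN, ?_⟩
  refine CInfZeroOn.congr isOpen_interior (𝓁.cInfZeroOn_integral isOpen_interior
    ((𝒳.cInfZeroOn_inv_act hf hφ).mono fun y hy => hsub hy) hC fun g w hw hg => ?_)
    fun y hy => ?_
  · refine image_eq_zero_of_notMem_tsupport fun h => hg ?_
    exact hCm g _ ⟨_, interior_subset hw, rfl⟩ (𝒳.family.fst_eq hφ (hsub hw)).symm h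
  · rw [average, 𝒳.family.fst_eq hφ (hsub hy)]
    refine integral_congr_ae ?_
    filter_upwards [𝓁.ae_r_eq y.1] with g hg
    rw [hg]

end CInfZeroGSpace

/-! ### Countably many bump functions -/

namespace CInfZeroGSpace

variable {G G₀ X A : Type*}
  [TopologicalSpace G] [T2Space G] [LocallyCompactSpace G] [SecondCountableTopology G]
  [MeasurableSpace G] [BorelSpace G]
  [TopologicalSpace G₀] [T2Space G₀] [LocallyCompactSpace G₀] [TopologicalSpace X]
  {𝒢 : ContinuousFamilyGroupoid G G₀} (𝓁 : ContinuousLeftHaarSystem 𝒢)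
  {p : X → G₀} (𝒳 : CInfZeroGSpace 𝒢 p)

/-- A sequence of bump functions subordinate to `U` whose averages have no common zero. -/
theorem exists_seq_average_pos [T2Space X] [SecondCountableTopology X] [Nonempty X]
    (hproper : 𝒳.IsProper) (U : A → Set X) (hU : ∀ α, IsOpen (U α))
    (hcover : ⋃ α, 𝒳.saturation (U α) = univ) :
    ∃ h : ℕ → X → ℝ, (∀ n, IsCInfZero 𝒳.family (h n) ∧ (∀ x, 0 ≤ h n x) ∧
      HasCompactSupport (h n) ∧ ∃ α, tsupport (h n) ⊆ U α) ∧
      ∀ x, ∃ n, 0 < 𝒳.average 𝓁 (h n) x := by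
  have hloc : ∀ x : X, ∃ h : X → ℝ, (IsCInfZero 𝒳.family h ∧ (∀ x, 0 ≤ h x) ∧
      HasCompactSupport h ∧ ∃ α, tsupport h ⊆ U α) ∧ 0 < 𝒳.average 𝓁 h x := by
    intro x
    obtain ⟨α, g, y, hy, hg, rfl⟩ := mem_iUnion.1 (hcover ▸ mem_univ x)
    obtain ⟨h, hs, h0, hc, hsub, hpos⟩ := 𝒳.family.exists_bump (hU α) hy
    refine ⟨h, ⟨hs, h0, hc, α, hsub⟩,
      average_pos 𝓁 hproper hs.1 hc h0 (𝒳.proj_act g y hg).symm ?_⟩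
    rwa [𝒳.inv_act g y hg]
  choose h hh hpos using hloc
  have hnhds : ∀ x, {y | 0 < 𝒳.average 𝓁 (h x) y} ∈ 𝓝 x := fun x =>
    (isOpen_lt continuous_const
      (isCInfZero_average 𝓁 hproper (hh x).1 (hh x).2.2.1).1).mem_nhds (hpos x)
  obtain ⟨s, hs, hsU⟩ := TopologicalSpace.countable_cover_nhds hnhds
  have hmem : ∀ x, ∃ y ∈ s, 0 < 𝒳.average 𝓁 (h y) x := fun x => by
    simpa using (hsU ▸ mem_univ x : x ∈ ⋃ y ∈ s, {z | 0 < 𝒳.average 𝓁 (h y) z})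
  -- The countable set `s` must be nonempty to be enumerated by `ℕ`.
  obtain ⟨y, hy, -⟩ := hmem (Classical.arbitrary X)
  obtain ⟨e, rfl⟩ := hs.exists_eq_range ⟨y, hy⟩
  refine ⟨fun n => h (e n), fun n => hh _, fun x => ?_⟩
  obtain ⟨_, ⟨n, rfl⟩, hn⟩ := hmem x
  exact ⟨n, hn⟩

end CInfZeroGSpace

/-! ### Making the family of averages locally finite -/

section Cutoff

variable {X : Type*}

/-- Smooth cutoffs which make a sequence of functions without common zero locally finite: the
`n`-th one vanishes where some earlier function is at least `1 / n`. -/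
noncomputable def seqCutoff (a : ℕ → X → ℝ) (n : ℕ) (x : X) : ℝ :=
  ∏ i ∈ Finset.range n, expNegInvGlue (1 - n * a i x)

theorem seqCutoff_nonneg (a : ℕ → X → ℝ) (n : ℕ) (x : X) : 0 ≤ seqCutoff a n x :=
  Finset.prod_nonneg fun _ _ => expNegInvGlue.nonneg _

theorem IsCInfZero.seqCutoff {T : Type*} [TopologicalSpace X] [TopologicalSpace T] {p : X → T}
    {𝓕 : ContinuousFamily p} {a : ℕ → X → ℝ} (ha : ∀ n, IsCInfZero 𝓕 (a n)) (n : ℕ) :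
    IsCInfZero 𝓕 (seqCutoff a n) :=
  IsCInfZero.prod _ fun i _ => (ha i).smooth_comp (b := fun t => expNegInvGlue (1 - n * t))
    isOpen_univ (expNegInvGlue.contDiff.comp (by fun_prop)).contDiffOn fun _ => mem_univ _

theorem locallyFinite_seqCutoff_mul [TopologicalSpace X] {a : ℕ → X → ℝ}
    (ha : ∀ n, Continuous (a n)) (hpos : ∀ x, ∃ n, 0 < a n x) :
    LocallyFinite fun n => Function.support fun x => seqCutoff a n x * a n x := by
  intro x
  obtain ⟨n, hn⟩ := hpos x
  obtain ⟨M, hM⟩ := exists_nat_gt (2 / a n x)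
  refine ⟨{y | a n x / 2 < a n y},
    (isOpen_lt continuous_const (ha n)).mem_nhds (half_lt_self hn), ?_⟩
  -- If `m ≥ n + 1`, the factor of index `n` occurs in the cutoff; if also `m ≥ M > 2 / a n x`, then
  -- `m * a n y ≥ 1` on the neighbourhood, so that factor is zero.
  refine (finite_Iio (max (n + 1) M)).subset ?_
  rintro m ⟨y, hy, hyn⟩
  by_contra hm
  simp only [mem_Iio, not_lt, max_le_iff] at hm
  refine hy (mul_eq_zero_of_left (Finset.prod_eq_zero (Finset.mem_range.2 hm.1)
    (expNegInvGlue.zero_of_nonpos ?_)) _)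
  have h1 : (M : ℝ) ≤ m := by exact_mod_cast hm.2
  have h2 : 2 / a n x ≤ m := hM.le.trans h1
  rw [div_le_iff₀ hn] at h2
  have h3 : (m : ℝ) * (a n x / 2) ≤ m * a n y :=
    mul_le_mul_of_nonneg_left (le_of_lt hyn) (Nat.cast_nonneg m)
  linarith

/-- At the first `n` with `a n x > 0` the earlier functions vanish, so every factor of the cutoff is
`expNegInvGlue 1 > 0`. -/
theorem finsum_seqCutoff_mul_pos [TopologicalSpace X] {a : ℕ → X → ℝ}
    (ha : ∀ n, Continuous (a n)) (ha0 : ∀ n x, 0 ≤ a n x) (hpos : ∀ x, ∃ n, 0 < a n x) (x : X) :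
    0 < ∑ᶠ n, seqCutoff a n x * a n x := by
  classical
  have hfirst : ∀ i < Nat.find (hpos x), a i x = 0 := fun i hi =>
    le_antisymm (not_lt.1 (Nat.find_min (hpos x) hi)) (ha0 i x)
  refine lt_of_lt_of_le (mul_pos ?_ (Nat.find_spec (hpos x))) (single_le_finsum _
    ((locallyFinite_seqCutoff_mul ha hpos).point_finite x)
    fun n => mul_nonneg (seqCutoff_nonneg a n x) (ha0 n x))
  refine Finset.prod_pos fun i hi => expNegInvGlue.pos_of_pos ?_
  simp [hfirst i (Finset.mem_range.1 hi)]

end Cutoff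

/-! ### Assembly of the partition of unity -/

theorem mainTheorem11 {G G₀ X A : Type*}
    [TopologicalSpace G] [T2Space G] [LocallyCompactSpace G] [SecondCountableTopology G]
    [MeasurableSpace G] [BorelSpace G]
    [TopologicalSpace G₀] [T2Space G₀] [LocallyCompactSpace G₀] [SecondCountableTopology G₀]
    [TopologicalSpace X] [T2Space X] [LocallyCompactSpace X] [SecondCountableTopology X]
    (𝒢 : ContinuousFamilyGroupoid G G₀) (𝓁 : ContinuousLeftHaarSystem 𝒢)
    {p : X → G₀} (𝒳 : CInfZeroGSpace 𝒢 p) (hproper : 𝒳.IsProper)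
    (U : A → Set X) (hU : ∀ α, IsOpen (U α)) (hcover : ⋃ α, 𝒳.saturation (U α) = univ) :
    ∃ (Δ : Type) (f : Δ → X → ℝ), IsGPartitionOfUnity 𝒳 𝓁 U f := by
  rcases isEmpty_or_nonempty X with hX | hX
  · exact ⟨Empty, fun e => e.elim, fun e => e.elim, fun e => e.elim, fun e => e.elim,
      fun e => e.elim, fun e => e.elim, fun x => isEmptyElim x, fun x => isEmptyElim x⟩
  obtain ⟨h, hh, hpos⟩ := 𝒳.exists_seq_average_pos 𝓁 hproper U hU hcover
  set a : ℕ → X → ℝ := fun n => 𝒳.average 𝓁 (h n) with ha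
  have has : ∀ n, IsCInfZero 𝒳.family (a n) := fun n =>
    CInfZeroGSpace.isCInfZero_average 𝓁 hproper (hh n).1 (hh n).2.2.1
  have hainv : ∀ n g x, 𝒢.s g = p x → a n (𝒳.act g x) = a n x := fun n g x hg =>
    CInfZeroGSpace.average_act 𝓁 hproper (hh n).1.1 (hh n).2.2.1 hg
  have hac := fun n => (has n).1
  have ha0 : ∀ n x, 0 ≤ a n x := fun n => CInfZeroGSpace.average_nonneg 𝓁 (hh n).2.1
  have hlf := locallyFinite_seqCutoff_mul hac hpos
  set S : X → ℝ := fun x => ∑ᶠ n, seqCutoff a n x * a n x with hS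
  have hS0 : ∀ x, 0 < S x := finsum_seqCutoff_mul_pos hac ha0 hpos
  have hSs : IsCInfZero 𝒳.family S :=
    IsCInfZero.finsum (fun n => (IsCInfZero.seqCutoff has n).mul (has n)) hlf
  -- Built from the invariant `a i` alone, `θ n` is invariant and leaves the integral; multiplying
  -- `h n` by it normalizes the averages without enlarging the support.
  set θ : ℕ → X → ℝ := fun n x => (S x)⁻¹ * seqCutoff a n x with hθ
  have hθs : ∀ n, IsCInfZero 𝒳.family (θ n) := fun n =>
    (hSs.smooth_comp (b := fun t => t⁻¹) isOpen_compl_singleton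
      (fun t ht => (contDiffAt_inv ℝ ht).contDiffWithinAt) fun x => (hS0 x).ne').mul
      (IsCInfZero.seqCutoff has n)
  have hθ0 : ∀ n x, 0 ≤ θ n x := fun n x =>
    mul_nonneg (inv_nonneg.2 (hS0 x).le) (seqCutoff_nonneg a n x)
  have hθinv : ∀ n g x, 𝒢.s g = p x → θ n (𝒳.act g x) = θ n x := by
    intro n g x hg
    simp only [hθ, hS, seqCutoff, fun i => hainv i g x hg]
  have hav : ∀ n x, ∫ g, θ n (𝒳.act (𝒢.inv g) x) * h n (𝒳.act (𝒢.inv g) x) ∂(𝓁.lam (p x)) =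
      (S x)⁻¹ * (seqCutoff a n x * a n x) := fun n x =>
    (CInfZeroGSpace.average_mul 𝓁 (hθinv n) x).trans (mul_assoc _ _ _)
  have hfs : ∀ n, IsCInfZero 𝒳.family fun x => θ n x * h n x := fun n => (hθs n).mul (hh n).1
  have hfc : ∀ n, HasCompactSupport fun x => θ n x * h n x := fun n =>
    (hh n).2.2.1.mul_left
  refine ⟨ℕ, fun n x => θ n x * h n x, hfs, fun n x => mul_nonneg (hθ0 n x) ((hh n).2.1 x), hfc,
    fun n => ?_, fun n x => CInfZeroGSpace.integrable_inv_act 𝓁 hproper (hfs n).1 (hfc n) x,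
    ?_, fun x => ?_⟩
  · obtain ⟨α, hα⟩ := (hh n).2.2.2
    exact ⟨α, (closure_mono (Function.support_mul_subset_right _ _)).trans hα⟩
  · simp only [hav]
    exact hlf.subset fun n => Function.support_mul_subset_right _ _
  · simp only [hav]
    rw [← mul_finsum]
    exact inv_mul_cancel₀ (hS0 x).ne'
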